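/- Let $\mathbb K$ be a field and let $H$ be a Hopf algebra over $\mathbb K$ with coproduct $\Delta(h)=h_1\otimes h_2$, counit $\epsilon$ and antipode $S$. Let $A$ be a right $H$-comodule algebra with coaction $\Delta_A\colon A\to A\otimes H$, $a\mapsto a_0\otimes a_1$, and let $B=A^{\mathrm{co}H}=\{b\in A:\Delta_A(b)=b\otimes 1\}$. Assume that $B\subseteq A$ is a quantum principal bundle, that is, $A$ is faithfully flat as a left $B$-module and the canonical map $A\otimes_BA\to A\otimes H$, $a\otimes_B a'\mapsto aa'_0\otimes a'_1$, is bijective. A differential calculus on an algebra is a differential $\mathbb N$-graded $\mathbb K$-algebra $\Omega^\bullet$ with $\Omega^0$ equal to that algebra and such that each $\Omega^k$ is spanned by the forms $a^0\,\mathrm da^1\wedge\dots\wedge\mathrm da^k$. Let $(\Gamma,\mathrm d)$ be a bicovariant first order differential calculus over $H$, and let $\Omega^\bullet(H)=\Gamma^\wedge$ be its maximal prolongation, that is, the quotient of the tensor algebra $\bigoplus_{n\ge 0}\Gamma^{\otimes_H n}$ by the ideal generated by all $\sum_i\mathrm da_i\otimes_H\mathrm db_i$ with $a_i,b_i\in H$,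 $\sum_ia_i\,\mathrm db_i=0$. It is a differential calculus on $H$. The left coaction of $H$ on $\Gamma$ and the coproduct of $H$ extend to a left coaction $\omega\mapsto\omega_{-1}\otimes\omega_0$ of $H$ on $\Gamma^\wedge$ that is an algebra morphism; let $\Lambda^\bullet=\{\theta\in\Gamma^\wedge:\theta_{-1}\otimes\theta_0=1\otimes\theta\}$ be the graded subalgebra of left coinvariant forms, which is closed under $\mathrm d$. Put $$\pi_{inv}\colon\Omega^\bullet(H)\to\Lambda^\bullet,\quad \pi_{inv}(\omega)=S(\omega_{-1})\omega_0,\qquad \theta\leftharpoonup h=S(h_1)\theta h_2,$$ $$\varpi(h)=S(h_1)\,\mathrm dh_2,\qquad \pi_\epsilon(h)=h-\epsilon(h)1 .$$ The algebra of vertical forms $\mathfrak{ver}^\bullet(A)$ is $A\otimes\Lambda^\bullet$, graded by the degree of $\Lambda^\bullet$, with $$(a\otimes\theta)\wedge(b\otimes\eta)=ab_0\otimes(\theta\leftharpoonup b_1)\wedge\eta,\qquad \mathrm d(a\otimes\theta)=a\otimes\mathrm d\theta+a_0\otimes\varpi(\pi_\epsilon(a_1))\wedge\theta ;$$ it is a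 differential graded algebra that contains $A$ through $a\mapsto a\otimes1$. Let $\Omega^\bullet(A)$ be a complete calculus on $A$, that is, a differential calculus on $A$ for which $\Delta_A$ extends to a morphism of differential graded algebras $\Delta_A^\wedge\colon\Omega^\bullet(A)\to\Omega^\bullet(A)\otimes\Omega^\bullet(H)$, where the target is the graded tensor product. Then there is a surjective morphism of differential graded algebras $$\pi_{\mathfrak{ver}}\colon\Omega^\bullet(A)\to\mathfrak{ver}^\bullet(A)$$ extending the identity of $A$, and it is the only morphism of differential graded algebras $\Omega^\bullet(A)\to\mathfrak{ver}^\bullet(A)$ that extends the identity of $A$. For every $k\ge0$ it is given on $\Omega^k(A)$ by $$\pi_{\mathfrak{ver}}|_{\Omega^k(A)}=(\mathrm{id}\otimes(\pi_{inv}\circ\pi_k))\circ\Delta_A^\wedge|_{\Omega^k(A)},$$ where $\pi_k\colon\Omega^\bullet(H)\to\Omega^k(H)$ is the projection (the right hand side takes values in $A\otimes\Lambda^k\subseteq\Omega^\bullet(A)\otimes\Lambda^\bullet$). Explicitly, for all $k\ge 0$ and $a^0,\dots,a^k\in A$, $$\pi_{\mathfrak{ver}}(a^0\,\mathrm da^1\wedge\dots\wedge\mathrm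 da^k)=a^0_0a^1_0\cdots a^k_0\otimes S(a^0_1a^1_1\cdots a^k_1)\,a^0_2\,\mathrm da^1_2\wedge\dots\wedge\mathrm da^k_2 .$$ -/

import Mathlib

open scoped TensorProduct

set_option linter.unusedSectionVars false

noncomputable section

namespace NCBundle

/-! ### Differential graded algebras and differential calculi -/

section DGA

variable {k Ω Ω' A : Type*} [Field k] [Ring Ω] [Algebra k Ω] [Ring Ω'] [Algebra k Ω']
  [Ring A] [Algebra k A]

/-- `(Ω, 𝒜, d)` is a differential `ℕ`-graded algebra over `k`. -/
structure IsDGA (𝒜 : ℕ → Submodule k Ω) (d : Ω →ₗ[k] Ω) : Prop where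
  graded : SetLike.GradedMonoid 𝒜
  internal : DirectSum.IsInternal 𝒜
  d_mem : ∀ n, ∀ x ∈ 𝒜 n, d x ∈ 𝒜 (n + 1)
  d_d : ∀ x, d (d x) = 0
  leibniz : ∀ n, ∀ x ∈ 𝒜 n, ∀ y, d (x * y) = d x * y + (-1 : k) ^ n • (x * d y)

/-- The form `a⁰ da¹ ∧ … ∧ daⁿ`, where `incl` is the inclusion of the algebra in degree zero. -/
def form (incl : A →ₐ[k] Ω) (d : Ω →ₗ[k] Ω) {n : ℕ} (a : Fin (n + 1) → A) : Ω :=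
  incl (a 0) * (List.ofFn fun i : Fin n => d (incl (a i.succ))).prod

/-- `(Ω, 𝒜, d)` is a differential calculus on `A`: a differential graded algebra whose degree zero
part is `A` (through `incl`) and which is generated in degree zero. -/
structure IsDifferentialCalculus (incl : A →ₐ[k] Ω) (𝒜 : ℕ → Submodule k Ω)
    (d : Ω →ₗ[k] Ω) : Prop extends IsDGA 𝒜 d where
  incl_injective : Function.Injective incl
  range_incl : LinearMap.range incl.toLinearMap = 𝒜 0
  generated : ∀ n, 𝒜 n = Submodule.span k (Set.range fun a : Fin (n + 1) → A => form incl d a)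

/-- An algebra morphism is a morphism of differential graded algebras if it has degree zero and
commutes with the differentials. -/
structure IsDGAHom (𝒜 : ℕ → Submodule k Ω) (d : Ω →ₗ[k] Ω) (ℬ : ℕ → Submodule k Ω')
    (d' : Ω' →ₗ[k] Ω') (f : Ω →ₐ[k] Ω') : Prop where
  map_mem : ∀ n, ∀ x ∈ 𝒜 n, f x ∈ ℬ n
  map_d : ∀ x, f (d x) = d' (f x)

/-- The involution `x ↦ (-1)^{|x|} x` of a graded algebra. -/
def gradeInvol (𝒜 : ℕ → Submodule k Ω) [GradedAlgebra 𝒜] : Ω →ₗ[k] Ω :=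
  DirectSum.toModule k ℕ Ω (fun n => (-1 : k) ^ n • (𝒜 n).subtype) ∘ₗ
    (DirectSum.decomposeLinearEquiv 𝒜).toLinearMap

/-- The total grading of the graded tensor product. -/
def tensorGrade (𝒜 : ℕ → Submodule k Ω) (ℬ : ℕ → Submodule k Ω') [GradedAlgebra 𝒜]
    [GradedAlgebra ℬ] (n : ℕ) : Submodule k (𝒜 ᵍ⊗[k] ℬ) :=
  ⨆ p ∈ Finset.HasAntidiagonal.antidiagonal n,
    (LinearMap.range (TensorProduct.map (𝒜 p.1).subtype (ℬ p.2).subtype)).map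
      (GradedTensorProduct.of k 𝒜 ℬ).toLinearMap

/-- The differential `d (x ⊗ y) = dx ⊗ y + (-1)^{|x|} x ⊗ dy` of the graded tensor product. -/
def tensorD (𝒜 : ℕ → Submodule k Ω) (d : Ω →ₗ[k] Ω) (ℬ : ℕ → Submodule k Ω')
    (d' : Ω' →ₗ[k] Ω') [GradedAlgebra 𝒜] [GradedAlgebra ℬ] : 𝒜 ᵍ⊗[k] ℬ →ₗ[k] 𝒜 ᵍ⊗[k] ℬ :=
  (GradedTensorProduct.of k 𝒜 ℬ).toLinearMap ∘ₗ
    (TensorProduct.map d LinearMap.id + TensorProduct.map (gradeInvol 𝒜) d') ∘ₗ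
      (GradedTensorProduct.of k 𝒜 ℬ).symm.toLinearMap

end DGA

/-! ### First order differential calculi -/

section FODC

variable (k H Γ : Type*) [Field k] [Ring H] [Algebra k H] [AddCommGroup Γ] [Module k Γ]
  [Module H Γ] [Module Hᵐᵒᵖ Γ] [SMulCommClass H Hᵐᵒᵖ Γ] [IsScalarTower k H Γ]
  [IsScalarTower k Hᵐᵒᵖ Γ]

/-- The left action of `H` on the bimodule `Γ` as a bilinear map, `(h, γ) ↦ h γ`. -/
def lact : H →ₗ[k] Γ →ₗ[k] Γ := (Algebra.lsmul k k Γ).toLinearMap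

/-- The right action of `H` on the bimodule `Γ` as a bilinear map, `(h, γ) ↦ γ h`. -/
def ract : H →ₗ[k] Γ →ₗ[k] Γ :=
  (Algebra.lsmul k k Γ : Hᵐᵒᵖ →ₐ[k] Module.End k Γ).toLinearMap ∘ₗ
    (MulOpposite.opLinearEquiv k).toLinearMap

@[simp] lemma lact_apply (h : H) (γ : Γ) : lact k H Γ h γ = h • γ := rfl

@[simp] lemma ract_apply (h : H) (γ : Γ) : ract k H Γ h γ = MulOpposite.op h • γ := rfl

/-- A first order differential calculus `(Γ, d)` over `H`, for an `H`-bimodule `Γ`. -/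
structure FODC where
  d : H →ₗ[k] Γ
  leibniz : ∀ a b, d (a * b) = MulOpposite.op b • d a + a • d b
  span_eq_top : Submodule.span k {ω | ∃ a b : H, ω = a • d b} = ⊤

/-- The relations that turn the free `k`-algebra on the vector space `H × Γ` into the tensor
algebra `H ⊕ Γ ⊕ (Γ ⊗_H Γ) ⊕ …` of the bimodule `Γ`. -/
inductive BimoduleRel : TensorAlgebra k (H × Γ) → TensorAlgebra k (H × Γ) → Prop
  | one : BimoduleRel (TensorAlgebra.ι k (1, 0)) 1
  | mul (a b : H) : BimoduleRel (TensorAlgebra.ι k (a * b, 0))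
      (TensorAlgebra.ι k (a, 0) * TensorAlgebra.ι k (b, 0))
  | left (a : H) (γ : Γ) : BimoduleRel (TensorAlgebra.ι k (0, a • γ))
      (TensorAlgebra.ι k (a, 0) * TensorAlgebra.ι k (0, γ))
  | right (a : H) (γ : Γ) : BimoduleRel (TensorAlgebra.ι k (0, MulOpposite.op a • γ))
      (TensorAlgebra.ι k (0, γ) * TensorAlgebra.ι k (a, 0))

/-- The tensor algebra `⨁ₙ Γ ⊗_H … ⊗_H Γ` of the `H`-bimodule `Γ`. -/
def BimoduleTensorAlgebra : Type _ := RingQuot (BimoduleRel k H Γ)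

instance : Ring (BimoduleTensorAlgebra k H Γ) :=
  inferInstanceAs (Ring (RingQuot (BimoduleRel k H Γ)))

instance : Algebra k (BimoduleTensorAlgebra k H Γ) :=
  inferInstanceAs (Algebra k (RingQuot (BimoduleRel k H Γ)))

/-- The quotient map from the free algebra on `H × Γ`. -/
def preProj : TensorAlgebra k (H × Γ) →ₐ[k] BimoduleTensorAlgebra k H Γ :=
  RingQuot.mkAlgHom k (BimoduleRel k H Γ)

lemma preProj_surjective : Function.Surjective (preProj k H Γ) :=
  RingQuot.mkAlgHom_surjective k (BimoduleRel k H Γ)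

lemma preProj_rel {x y : TensorAlgebra k (H × Γ)} (h : BimoduleRel k H Γ x y) :
    preProj k H Γ x = preProj k H Γ y :=
  RingQuot.mkAlgHom_rel k h

/-- The inclusion of `Γ` in its tensor algebra. -/
def tensorInΓ : Γ →ₗ[k] BimoduleTensorAlgebra k H Γ :=
  (preProj k H Γ).toLinearMap ∘ₗ TensorAlgebra.ι k ∘ₗ LinearMap.inr k H Γ

end FODC

namespace FODC

section MaxProlong

variable {k H Γ : Type*} [Field k] [Ring H] [Algebra k H] [AddCommGroup Γ] [Module k Γ]
  [Module H Γ] [Module Hᵐᵒᵖ Γ] [SMulCommClass H Hᵐᵒᵖ Γ] [IsScalarTower k H Γ]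
  [IsScalarTower k Hᵐᵒᵖ Γ] (F : FODC k H Γ)

/-- The surjection `a ⊗ b ↦ a db` of `H ⊗ H` onto `Γ`. -/
def adb : H ⊗[k] H →ₗ[k] Γ := TensorProduct.lift ((lact k H Γ).compl₂ F.d)

/-- The linear map `a ⊗ b ↦ f (da) f (db)`, for a linear map `f` to an algebra. -/
def dadb {R : Type*} [Semiring R] [Algebra k R] (f : Γ →ₗ[k] R) : H ⊗[k] H →ₗ[k] R :=
  LinearMap.mul' k R ∘ₗ TensorProduct.map (f ∘ₗ F.d) (f ∘ₗ F.d)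

@[simp] lemma adb_tmul (a b : H) : F.adb (a ⊗ₜ b) = a • F.d b := rfl

@[simp] lemma dadb_tmul {R : Type*} [Semiring R] [Algebra k R] (f : Γ →ₗ[k] R) (a b : H) :
    F.dadb f (a ⊗ₜ b) = f (F.d a) * f (F.d b) := rfl

/-- The generators `∑ᵢ daᵢ ⊗_H dbᵢ`, where `∑ᵢ aᵢ dbᵢ = 0`, of the ideal to be divided out. -/
inductive WedgeRel : BimoduleTensorAlgebra k H Γ → BimoduleTensorAlgebra k H Γ → Prop
  | of (t : H ⊗[k] H) (ht : F.adb t = 0) : WedgeRel (F.dadb (tensorInΓ k H Γ) t) 0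

/-- The maximal prolongation `Γ^∧` of the first order differential calculus. -/
def MaxProlong : Type _ := RingQuot F.WedgeRel

instance : Ring F.MaxProlong := inferInstanceAs (Ring (RingQuot F.WedgeRel))

instance : Algebra k F.MaxProlong := inferInstanceAs (Algebra k (RingQuot F.WedgeRel))

/-- The quotient map from the tensor algebra of `Γ`. -/
def wedgeProj : BimoduleTensorAlgebra k H Γ →ₐ[k] F.MaxProlong :=
  RingQuot.mkAlgHom k F.WedgeRel

lemma wedgeProj_surjective : Function.Surjective F.wedgeProj :=
  RingQuot.mkAlgHom_surjective k F.WedgeRel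

lemma wedgeProj_rel {x y : BimoduleTensorAlgebra k H Γ} (h : F.WedgeRel x y) :
    F.wedgeProj x = F.wedgeProj y :=
  RingQuot.mkAlgHom_rel k h

/-- The quotient map from the free algebra on `H × Γ`. -/
def proj : TensorAlgebra k (H × Γ) →ₐ[k] F.MaxProlong := F.wedgeProj.comp (preProj k H Γ)

lemma proj_surjective : Function.Surjective F.proj :=
  F.wedgeProj_surjective.comp (preProj_surjective k H Γ)

lemma proj_rel {x y : TensorAlgebra k (H × Γ)} (h : BimoduleRel k H Γ x y) :
    F.proj x = F.proj y :=
  congrArg F.wedgeProj (preProj_rel k H Γ h)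

/-- The inclusion of `Γ` in `Γ^∧`. -/
def inΓ : Γ →ₗ[k] F.MaxProlong :=
  F.proj.toLinearMap ∘ₗ TensorAlgebra.ι k ∘ₗ LinearMap.inr k H Γ

/-- The inclusion of `H` in `Γ^∧`. -/
def inH : H →ₐ[k] F.MaxProlong :=
  AlgHom.ofLinearMap (F.proj.toLinearMap ∘ₗ TensorAlgebra.ι k ∘ₗ LinearMap.inl k H Γ)
    (by simpa using F.proj_rel BimoduleRel.one)
    (fun a b => by simpa using F.proj_rel (BimoduleRel.mul a b))

lemma inΓ_smul (a : H) (γ : Γ) : F.inΓ (a • γ) = F.inH a * F.inΓ γ := by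
  simpa [inΓ, inH] using F.proj_rel (BimoduleRel.left a γ)

lemma inΓ_op_smul (a : H) (γ : Γ) : F.inΓ (MulOpposite.op a • γ) = F.inΓ γ * F.inH a := by
  simpa [inΓ, inH] using F.proj_rel (BimoduleRel.right a γ)

lemma map_dadb {R R' : Type*} [Semiring R] [Algebra k R] [Semiring R'] [Algebra k R'] (f : Γ →ₗ[k] R)
    (g : R →ₐ[k] R') (t : H ⊗[k] H) : g (F.dadb f t) = F.dadb (g.toLinearMap ∘ₗ f) t := by
  induction t with
  | zero => simp
  | tmul a b => simp
  | add x y hx hy => simp [hx, hy]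

lemma dadb_inΓ_eq_zero {t : H ⊗[k] H} (ht : F.adb t = 0) : F.dadb F.inΓ t = 0 := by
  have h := F.wedgeProj_rel (WedgeRel.of t ht)
  rw [map_zero, map_dadb] at h
  exact h

variable {R : Type*} [Semiring R] [Algebra k R]

/-- The universal property of the tensor algebra of a bimodule. -/
def preLift (φ : H →ₐ[k] R) (g : Γ →ₗ[k] R) (hl : ∀ a γ, g (a • γ) = φ a * g γ)
    (hr : ∀ (a : H) γ, g (MulOpposite.op a • γ) = g γ * φ a) :
    BimoduleTensorAlgebra k H Γ →ₐ[k] R :=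
  RingQuot.liftAlgHom k (s := BimoduleRel k H Γ)
    ⟨TensorAlgebra.lift k (φ.toLinearMap.coprod g), fun x y h => by
      cases h <;> simp [hl, hr]⟩

lemma preLift_preProj (φ : H →ₐ[k] R) (g : Γ →ₗ[k] R) (hl : ∀ a γ, g (a • γ) = φ a * g γ)
    (hr : ∀ (a : H) γ, g (MulOpposite.op a • γ) = g γ * φ a) (x : TensorAlgebra k (H × Γ)) :
    preLift φ g hl hr (preProj k H Γ x) = TensorAlgebra.lift k (φ.toLinearMap.coprod g) x :=
  RingQuot.liftAlgHom_mkAlgHom_apply k _ _ x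

lemma preLift_tensorInΓ (φ : H →ₐ[k] R) (g : Γ →ₗ[k] R) (hl : ∀ a γ, g (a • γ) = φ a * g γ)
    (hr : ∀ (a : H) γ, g (MulOpposite.op a • γ) = g γ * φ a) :
    (preLift φ g hl hr).toLinearMap ∘ₗ tensorInΓ k H Γ = g := by
  ext γ
  exact (preLift_preProj φ g hl hr _).trans (by simp)

/-- The universal property of `Γ^∧`. -/
def lift (φ : H →ₐ[k] R) (g : Γ →ₗ[k] R) (hl : ∀ a γ, g (a • γ) = φ a * g γ)
    (hr : ∀ (a : H) γ, g (MulOpposite.op a • γ) = g γ * φ a)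
    (hw : ∀ t, F.adb t = 0 → F.dadb g t = 0) : F.MaxProlong →ₐ[k] R :=
  RingQuot.liftAlgHom k (s := F.WedgeRel) ⟨preLift φ g hl hr, fun x y h => by
    cases h with
    | of t ht => rw [map_dadb, map_zero, preLift_tensorInΓ, hw t ht]⟩

section lift

variable (φ : H →ₐ[k] R) (g : Γ →ₗ[k] R) (hl : ∀ a γ, g (a • γ) = φ a * g γ)
    (hr : ∀ (a : H) γ, g (MulOpposite.op a • γ) = g γ * φ a)
    (hw : ∀ t, F.adb t = 0 → F.dadb g t = 0)

lemma lift_proj (x : TensorAlgebra k (H × Γ)) :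
    F.lift φ g hl hr hw (F.proj x) = TensorAlgebra.lift k (φ.toLinearMap.coprod g) x :=
  (RingQuot.liftAlgHom_mkAlgHom_apply k _ _ _).trans (preLift_preProj φ g hl hr x)

@[simp] lemma lift_inH (h : H) : F.lift φ g hl hr hw (F.inH h) = φ h :=
  (F.lift_proj φ g hl hr hw _).trans (by simp)

@[simp] lemma lift_inΓ (γ : Γ) : F.lift φ g hl hr hw (F.inΓ γ) = g γ :=
  (F.lift_proj φ g hl hr hw _).trans (by simp)

end lift

/-- `Γ^∧` is generated by `H` and `Γ`. -/
lemma induction {p : F.MaxProlong → Prop} (inH : ∀ h, p (F.inH h)) (inΓ : ∀ γ, p (F.inΓ γ))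
    (mul : ∀ x y, p x → p y → p (x * y)) (add : ∀ x y, p x → p y → p (x + y)) (x) : p x := by
  obtain ⟨x, rfl⟩ := F.proj_surjective x
  induction x using TensorAlgebra.induction with
  | algebraMap r => simpa using inH (algebraMap k H r)
  | ι x =>
    have : x = LinearMap.inl k H Γ x.1 + LinearMap.inr k H Γ x.2 := by simp
    rw [this, map_add, map_add]
    exact add _ _ (inH _) (inΓ _)
  | mul a b ha hb => rw [map_mul]; exact mul _ _ ha hb
  | add a b ha hb => rw [map_add]; exact add _ _ ha hb

lemma algHom_ext {f g : F.MaxProlong →ₐ[k] R} (h₁ : ∀ h, f (F.inH h) = g (F.inH h))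
    (h₂ : ∀ γ, f (F.inΓ γ) = g (F.inΓ γ)) : f = g := by
  refine AlgHom.ext fun x => ?_
  induction x using F.induction with
  | inH h => exact h₁ h
  | inΓ γ => exact h₂ γ
  | mul x y hx hy => simp [hx, hy]
  | add x y hx hy => simp [hx, hy]

/-- The component of degree `n` of `Γ^∧`: the span of the products `h γ₁ ∧ … ∧ γₙ`. -/
def grade (n : ℕ) : Submodule k F.MaxProlong :=
  LinearMap.range F.inH.toLinearMap * LinearMap.range F.inΓ ^ n

lemma inH_mem_grade (h : H) : F.inH h ∈ F.grade 0 := by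
  simp [grade]

lemma inΓ_mem_grade (γ : Γ) : F.inΓ γ ∈ F.grade 1 := by
  rw [← one_mul (F.inΓ γ), ← map_one F.inH, grade, pow_one]
  exact Submodule.mul_mem_mul ⟨1, rfl⟩ ⟨γ, rfl⟩

lemma range_pow_mul_le (n : ℕ) :
    LinearMap.range F.inΓ ^ n * LinearMap.range F.inH.toLinearMap ≤ F.grade n := by
  induction n with
  | zero => simp [grade]
  | succ n ih =>
    have h : LinearMap.range F.inΓ * LinearMap.range F.inH.toLinearMap ≤
        LinearMap.range F.inH.toLinearMap * LinearMap.range F.inΓ := by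
      rw [Submodule.mul_le]
      rintro _ ⟨γ, rfl⟩ _ ⟨h, rfl⟩
      rw [AlgHom.toLinearMap_apply, ← inΓ_op_smul, ← one_mul (F.inΓ _), ← map_one F.inH]
      exact Submodule.mul_mem_mul ⟨1, rfl⟩ ⟨_, rfl⟩
    calc _ = LinearMap.range F.inΓ ^ n *
          (LinearMap.range F.inΓ * LinearMap.range F.inH.toLinearMap) := by
          rw [pow_succ, mul_assoc]
      _ ≤ LinearMap.range F.inΓ ^ n *
          (LinearMap.range F.inH.toLinearMap * LinearMap.range F.inΓ) :=
          mul_le_mul' le_rfl h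
      _ = LinearMap.range F.inΓ ^ n * LinearMap.range F.inH.toLinearMap *
          LinearMap.range F.inΓ := (mul_assoc _ _ _).symm
      _ ≤ F.grade n * LinearMap.range F.inΓ := mul_le_mul' ih le_rfl
      _ = _ := by rw [grade, grade, pow_succ, mul_assoc]

instance : SetLike.GradedMonoid F.grade where
  one_mem := by simpa using F.inH_mem_grade 1
  mul_mem := by
    intro m n x y hx hy
    have h : F.grade m * F.grade n ≤ F.grade (m + n) := by
      have hH : LinearMap.range F.inH.toLinearMap * LinearMap.range F.inH.toLinearMap ≤
          LinearMap.range F.inH.toLinearMap := by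
        rw [Submodule.mul_le]
        rintro _ ⟨a, rfl⟩ _ ⟨b, rfl⟩
        exact ⟨a * b, by simp⟩
      calc F.grade m * F.grade n
          = LinearMap.range F.inH.toLinearMap * (LinearMap.range F.inΓ ^ m *
              LinearMap.range F.inH.toLinearMap) * LinearMap.range F.inΓ ^ n := by
            simp only [grade, mul_assoc]
        _ ≤ LinearMap.range F.inH.toLinearMap * F.grade m * LinearMap.range F.inΓ ^ n :=
            mul_le_mul' (mul_le_mul' le_rfl (F.range_pow_mul_le m)) le_rfl
        _ = LinearMap.range F.inH.toLinearMap * LinearMap.range F.inH.toLinearMap *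
              (LinearMap.range F.inΓ ^ (m + n)) := by simp only [grade, mul_assoc, pow_add]
        _ ≤ F.grade (m + n) := mul_le_mul' hH le_rfl
    exact h (Submodule.mul_mem_mul hx hy)

lemma of_eq_of {m n : ℕ} (h : m = n) {x : F.grade m} {y : F.grade n} (hxy : (x : F.MaxProlong) = y) :
    DirectSum.of (fun n => F.grade n) m x = DirectSum.of (fun n => F.grade n) n y := by
  subst h
  rw [Subtype.ext hxy]

/-- The inclusion of `H` in the direct sum of the homogeneous components. -/
def decomposeH : H →ₐ[k] DirectSum ℕ fun n => F.grade n :=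
  AlgHom.ofLinearMap (DirectSum.lof k ℕ (fun n => F.grade n) 0 ∘ₗ
        F.inH.toLinearMap.codRestrict _ F.inH_mem_grade)
      (F.of_eq_of rfl (map_one F.inH))
      (fun a b => by
        simp only [LinearMap.comp_apply, DirectSum.lof_eq_of, DirectSum.of_mul_of]
        exact F.of_eq_of rfl (map_mul F.inH a b))

/-- The inclusion of `Γ` in the direct sum of the homogeneous components. -/
def decomposeΓ : Γ →ₗ[k] DirectSum ℕ fun n => F.grade n :=
  DirectSum.lof k ℕ (fun n => F.grade n) 1 ∘ₗ F.inΓ.codRestrict _ F.inΓ_mem_grade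

lemma decomposeH_apply (h : H) : F.decomposeH h =
    DirectSum.of (fun n => F.grade n) 0 ⟨F.inH h, F.inH_mem_grade h⟩ := rfl

lemma decomposeΓ_apply (γ : Γ) : F.decomposeΓ γ =
    DirectSum.of (fun n => F.grade n) 1 ⟨F.inΓ γ, F.inΓ_mem_grade γ⟩ := rfl

lemma dadb_mem_grade (t : H ⊗[k] H) : F.dadb F.inΓ t ∈ F.grade 2 := by
  induction t with
  | zero => simp
  | tmul a b =>
    rw [dadb_tmul, ← one_add_one_eq_two]
    exact SetLike.mul_mem_graded (F.inΓ_mem_grade (F.d a)) (F.inΓ_mem_grade (F.d b))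
  | add x y hx hy => rw [map_add]; exact add_mem hx hy

lemma dadb_decomposeΓ (t : H ⊗[k] H) : F.dadb F.decomposeΓ t =
    DirectSum.of (fun n => F.grade n) 2 ⟨F.dadb F.inΓ t, F.dadb_mem_grade t⟩ := by
  have h : F.dadb F.decomposeΓ = DirectSum.lof k ℕ (fun n => F.grade n) 2 ∘ₗ
      (F.dadb F.inΓ).codRestrict _ F.dadb_mem_grade := by
    ext a b : 3
    simp only [TensorProduct.AlgebraTensorModule.curry_apply, TensorProduct.curry_apply,
      LinearMap.restrictScalars_self, LinearMap.coe_comp, Function.comp_apply, dadb_tmul,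
      decomposeΓ_apply, DirectSum.lof_eq_of, DirectSum.of_mul_of]
    exact F.of_eq_of rfl rfl
  rw [h]; rfl

/-- The algebra morphism that decomposes forms into their homogeneous components. -/
def decomposeHom : F.MaxProlong →ₐ[k] DirectSum ℕ fun n => F.grade n :=
  F.lift F.decomposeH F.decomposeΓ
    (fun a γ => by
      rw [decomposeH_apply, decomposeΓ_apply, decomposeΓ_apply, DirectSum.of_mul_of]
      exact F.of_eq_of rfl (F.inΓ_smul a γ))
    (fun a γ => by
      rw [decomposeH_apply, decomposeΓ_apply, decomposeΓ_apply, DirectSum.of_mul_of]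
      exact F.of_eq_of rfl (F.inΓ_op_smul a γ))
    (fun t ht => by
      rw [dadb_decomposeΓ, ← map_zero (DirectSum.of (fun n => F.grade n) 2)]
      exact F.of_eq_of rfl (F.dadb_inΓ_eq_zero ht))

lemma decomposeHom_of_mem {n : ℕ} {x : F.MaxProlong} (hx : x ∈ F.grade n) :
    F.decomposeHom x = DirectSum.of (fun n => F.grade n) n ⟨x, hx⟩ := by
  induction n generalizing x with
  | zero =>
    obtain ⟨h, rfl⟩ : ∃ h, F.inH h = x := by simpa [grade] using hx
    rw [decomposeHom, lift_inH, decomposeH_apply]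
  | succ n ih =>
    have hx' : x ∈ F.grade n * LinearMap.range F.inΓ := by
      rwa [grade, mul_assoc, ← pow_succ]
    have key : ∀ y ∈ F.grade n * LinearMap.range F.inΓ, ∃ hy : y ∈ F.grade (n + 1),
        F.decomposeHom y = DirectSum.of (fun n => F.grade n) (n + 1) ⟨y, hy⟩ := by
      intro y hy
      induction hy using Submodule.mul_induction_on' with
      | mem_mul_mem u hu v hv =>
        obtain ⟨γ, rfl⟩ := hv
        refine ⟨SetLike.mul_mem_graded hu (F.inΓ_mem_grade γ), ?_⟩
        rw [map_mul, ih hu, decomposeHom, lift_inΓ, decomposeΓ_apply, DirectSum.of_mul_of]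
        exact F.of_eq_of rfl rfl
      | add u _ v _ hu hv =>
        obtain ⟨hu, hu'⟩ := hu
        obtain ⟨hv, hv'⟩ := hv
        refine ⟨add_mem hu hv, ?_⟩
        rw [map_add, hu', hv', ← map_add]
        rfl
    exact (key x hx').2

instance : GradedAlgebra F.grade :=
  GradedAlgebra.ofAlgHom F.grade F.decomposeHom
    (F.algHom_ext
      (fun h => by simp [decomposeHom, decomposeH_apply])
      (fun γ => by simp [decomposeHom, decomposeΓ_apply]))
    (fun _ x => F.decomposeHom_of_mem x.2)

/-! The differential of `Γ^∧`. -/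

lemma adb_surjective : Function.Surjective F.adb := by
  rw [← LinearMap.range_eq_top, ← top_le_iff, ← F.span_eq_top, Submodule.span_le]
  rintro _ ⟨a, b, rfl⟩
  exact ⟨a ⊗ₜ b, rfl⟩

/-- The differential on one-forms, `a db ↦ da ∧ db`. -/
def d₁ : Γ →ₗ[k] F.MaxProlong :=
  (LinearMap.ker F.adb).liftQ (F.dadb F.inΓ) (fun _ ht => F.dadb_inΓ_eq_zero (LinearMap.mem_ker.1 ht)) ∘ₗ
    (F.adb.quotKerEquivOfSurjective F.adb_surjective).symm.toLinearMap

lemma d₁_adb (t : H ⊗[k] H) : F.d₁ (F.adb t) = F.dadb F.inΓ t := by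
  have : (F.adb.quotKerEquivOfSurjective F.adb_surjective).symm (F.adb t) =
      Submodule.Quotient.mk t := by
    rw [LinearEquiv.symm_apply_eq]; rfl
  rw [d₁, LinearMap.comp_apply, LinearEquiv.coe_coe, this]
  exact Submodule.liftQ_apply _ _ _

lemma d_one : F.d 1 = 0 := by
  have := F.leibniz 1 1
  simpa using this

lemma d₁_d (a : H) : F.d₁ (F.d a) = 0 := by
  have := F.d₁_adb (1 ⊗ₜ a)
  simpa [d_one] using this

lemma d₁_smul (a : H) (γ : Γ) :
    F.d₁ (a • γ) = F.inΓ (F.d a) * F.inΓ γ + F.inH a * F.d₁ γ := by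
  obtain ⟨t, rfl⟩ := F.adb_surjective γ
  induction t with
  | zero => simp
  | tmul b c =>
    have h : a • F.adb (b ⊗ₜ c) = F.adb ((a * b) ⊗ₜ c) := by simp [mul_smul]
    rw [h, d₁_adb, d₁_adb]
    simp [leibniz, inΓ_smul, inΓ_op_smul, add_mul, mul_assoc]
  | add x y hx hy =>
    simp only [map_add, smul_add, hx, hy, mul_add]; abel

lemma d₁_op_smul (a : H) (γ : Γ) :
    F.d₁ (MulOpposite.op a • γ) = F.d₁ γ * F.inH a - F.inΓ γ * F.inΓ (F.d a) := by
  obtain ⟨t, rfl⟩ := F.adb_surjective γ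
  induction t with
  | zero => simp
  | tmul b c =>
    have h : MulOpposite.op a • F.adb (b ⊗ₜ c) = F.adb (b ⊗ₜ (c * a) - (b * c) ⊗ₜ a) := by
      simp [leibniz, mul_smul, smul_comm]
    rw [h, d₁_adb, d₁_adb]
    simp only [leibniz, map_sub, dadb_tmul, map_add, inΓ_smul, inΓ_op_smul, add_mul, mul_add,
      mul_assoc, adb_tmul]
    abel
  | add x y hx hy =>
    simp only [map_add, smul_add, hx, hy, add_mul]; abel

/-- The restriction of `dHom` to `H`. -/
def dHomH : H →ₐ[k] Matrix (Fin 2) (Fin 2) F.MaxProlong :=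
  AlgHom.ofLinearMap
    { toFun := fun h => !![F.inH h, F.inΓ (F.d h); 0, F.inH h]
      map_add' := fun a b => by simp
      map_smul' := fun r a => by simp }
    (by simp [d_one, Matrix.one_fin_two])
    (fun a b => by simp [leibniz, inΓ_smul, inΓ_op_smul, add_comm])

/-- The restriction of `dHom` to `Γ`. -/
def dHomΓ : Γ →ₗ[k] Matrix (Fin 2) (Fin 2) F.MaxProlong where
  toFun γ := !![-F.inΓ γ, F.d₁ γ; 0, F.inΓ γ]
  map_add' a b := by simp [add_comm]
  map_smul' r a := by simp

lemma dHomH_apply (h : H) : F.dHomH h = !![F.inH h, F.inΓ (F.d h); 0, F.inH h] := rfl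

lemma dHomΓ_apply (γ : Γ) : F.dHomΓ γ = !![-F.inΓ γ, F.d₁ γ; 0, F.inΓ γ] := rfl

lemma dadb_dHomΓ (t : H ⊗[k] H) :
    F.dadb F.dHomΓ t = !![F.dadb F.inΓ t, 0; 0, F.dadb F.inΓ t] := by
  induction t with
  | zero => simp [← Matrix.ext_iff, Fin.forall_fin_two]
  | tmul a b => simp [dHomΓ_apply, d₁_d]
  | add x y hx hy => simp [hx, hy]

/-- The algebra morphism `x ↦ !![(-1)^{|x|} x, dx; 0, x]` that encodes the graded Leibniz rule. -/
def dHom : F.MaxProlong →ₐ[k] Matrix (Fin 2) (Fin 2) F.MaxProlong :=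
  F.lift F.dHomH F.dHomΓ
    (fun a γ => by simp [dHomH_apply, dHomΓ_apply, inΓ_smul, d₁_smul, add_comm])
    (fun a γ => by simp [dHomH_apply, dHomΓ_apply, inΓ_op_smul, d₁_op_smul, sub_eq_neg_add])
    (fun t ht => by
      rw [dadb_dHomΓ, F.dadb_inΓ_eq_zero ht]
      simp [← Matrix.ext_iff, Fin.forall_fin_two])

/-- The differential of `Γ^∧`. -/
def D : F.MaxProlong →ₗ[k] F.MaxProlong :=
  Matrix.entryLinearMap k F.MaxProlong 0 1 ∘ₗ F.dHom.toLinearMap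

lemma D_inH (h : H) : F.D (F.inH h) = F.inΓ (F.d h) := by
  simp [D, dHom, dHomH_apply]

lemma D_inΓ (γ : Γ) : F.D (F.inΓ γ) = F.d₁ γ := by
  simp [D, dHom, dHomΓ_apply]

lemma dHom_lower (x : F.MaxProlong) : F.dHom x 1 0 = 0 ∧ F.dHom x 1 1 = x := by
  induction x using F.induction with
  | inH h => simp [dHom, dHomH_apply]
  | inΓ γ => simp [dHom, dHomΓ_apply]
  | mul x y hx hy => simp [Matrix.mul_apply, hx, hy]
  | add x y hx hy => simp [hx, hy]

lemma dHom_mul_zero_zero (x y : F.MaxProlong) :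
    F.dHom (x * y) 0 0 = F.dHom x 0 0 * F.dHom y 0 0 := by
  simp [Matrix.mul_apply, F.dHom_lower y]

lemma D_mul' (x y : F.MaxProlong) : F.D (x * y) = F.D x * y + F.dHom x 0 0 * F.D y := by
  simp [D, Matrix.mul_apply, F.dHom_lower y, add_comm]

lemma dHom_zero_zero {n : ℕ} {x : F.MaxProlong} (hx : x ∈ F.grade n) :
    F.dHom x 0 0 = (-1 : k) ^ n • x := by
  induction n generalizing x with
  | zero =>
    obtain ⟨h, rfl⟩ : ∃ h, F.inH h = x := by simpa [grade] using hx
    simp [dHom, dHomH_apply]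
  | succ n ih =>
    have hx' : x ∈ F.grade n * LinearMap.range F.inΓ := by
      rwa [grade, mul_assoc, ← pow_succ]
    induction hx' using Submodule.mul_induction_on' with
    | mem_mul_mem u hu v hv =>
      obtain ⟨γ, rfl⟩ := hv
      rw [dHom_mul_zero_zero, ih hu]
      simp [dHom, dHomΓ_apply, pow_succ]
    | add u hu v hv hu' hv' =>
      have hs : F.grade n * LinearMap.range F.inΓ = F.grade (n + 1) := by
        rw [grade, mul_assoc, ← pow_succ]; rfl
      rw [map_add, Matrix.add_apply, hu' (hs ▸ hu), hv' (hs ▸ hv), smul_add]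

lemma D_mul {n : ℕ} {x : F.MaxProlong} (hx : x ∈ F.grade n) (y : F.MaxProlong) :
    F.D (x * y) = F.D x * y + (-1 : k) ^ n • (x * F.D y) := by
  rw [D_mul', F.dHom_zero_zero hx, smul_mul_assoc]

end MaxProlong
end FODC

namespace FODC
section MaxProlongCalculus

variable {k H Γ : Type*} [Field k] [Ring H] [Algebra k H] [AddCommGroup Γ] [Module k Γ]
  [Module H Γ] [Module Hᵐᵒᵖ Γ] [SMulCommClass H Hᵐᵒᵖ Γ] [IsScalarTower k H Γ]
  [IsScalarTower k Hᵐᵒᵖ Γ] (F : FODC k H Γ)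

lemma grade_succ (n : ℕ) : F.grade (n + 1) = F.grade n * LinearMap.range F.inΓ := by
  rw [grade, grade, mul_assoc, ← pow_succ]

lemma d₁_mem_grade (γ : Γ) : F.d₁ γ ∈ F.grade 2 := by
  obtain ⟨t, rfl⟩ := F.adb_surjective γ
  rw [d₁_adb]
  exact F.dadb_mem_grade t

lemma D_mem_grade {n : ℕ} {x : F.MaxProlong} (hx : x ∈ F.grade n) : F.D x ∈ F.grade (n + 1) := by
  induction n generalizing x with
  | zero =>
    obtain ⟨h, rfl⟩ : ∃ h, F.inH h = x := by simpa [grade] using hx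
    rw [D_inH]
    exact F.inΓ_mem_grade _
  | succ n ih =>
    rw [grade_succ] at hx
    induction hx using Submodule.mul_induction_on' with
    | mem_mul_mem u hu v hv =>
      obtain ⟨γ, rfl⟩ := hv
      rw [F.D_mul hu, D_inΓ]
      refine add_mem (SetLike.mul_mem_graded (ih hu) (F.inΓ_mem_grade γ))
        (Submodule.smul_mem _ _ ?_)
      have h := SetLike.mul_mem_graded hu (F.d₁_mem_grade γ)
      exact h
    | add u _ v _ hu hv => rw [map_add]; exact add_mem hu hv

lemma D_d₁ (γ : Γ) : F.D (F.d₁ γ) = 0 := by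
  obtain ⟨t, rfl⟩ := F.adb_surjective γ
  rw [d₁_adb]
  induction t with
  | zero => simp
  | tmul a b => rw [dadb_tmul, F.D_mul (F.inΓ_mem_grade _), D_inΓ, D_inΓ, d₁_d, d₁_d]; simp
  | add x y hx hy => rw [map_add, map_add, hx, hy, add_zero]

lemma D_D_of_mem {n : ℕ} {x : F.MaxProlong} (hx : x ∈ F.grade n) : F.D (F.D x) = 0 := by
  induction n generalizing x with
  | zero =>
    obtain ⟨h, rfl⟩ : ∃ h, F.inH h = x := by simpa [grade] using hx
    rw [D_inH, D_inΓ, d₁_d]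
  | succ n ih =>
    rw [grade_succ] at hx
    induction hx using Submodule.mul_induction_on' with
    | mem_mul_mem u hu v hv =>
      obtain ⟨γ, rfl⟩ := hv
      rw [F.D_mul hu, D_inΓ, map_add, map_smul, F.D_mul (F.D_mem_grade hu), F.D_mul hu, ih hu,
        D_d₁, D_inΓ, pow_succ]
      simp
    | add u _ v _ hu hv => rw [map_add, map_add, hu, hv, add_zero]

lemma D_D (x : F.MaxProlong) : F.D (F.D x) = 0 := by
  induction x using DirectSum.Decomposition.inductionOn F.grade with
  | zero => simp
  | homogeneous x => exact F.D_D_of_mem x.2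
  | add x y hx hy => rw [map_add, map_add, hx, hy, add_zero]

lemma inH_injective : Function.Injective F.inH := by
  have h : ∀ t : H ⊗[k] H, F.dadb (0 : Γ →ₗ[k] H) t = 0 := fun t => by
    simp [dadb]
  exact Function.LeftInverse.injective
    (g := F.lift (AlgHom.id k H) 0 (by simp) (by simp) (fun t _ => h t)) fun x => by simp

lemma form_mul_D {n : ℕ} (a : Fin (n + 1) → H) (b : H) :
    form F.inH F.D a * F.D (F.inH b) =
      form F.inH F.D (Fin.snoc (α := fun _ => H) a b : Fin (n + 2) → H) := by
  rw [form, form, List.ofFn_succ', List.concat_eq_append, List.prod_append, mul_assoc]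
  have h0 : (Fin.snoc (α := fun _ => H) a b : Fin (n + 2) → H) 0 = a 0 := by
    rw [← Fin.castSucc_zero, Fin.snoc_castSucc]
  have hl : (Fin.snoc (α := fun _ => H) a b : Fin (n + 2) → H) (Fin.last n).succ = b := by
    rw [Fin.succ_last, Fin.snoc_last]
  have hi : ∀ i : Fin n, (Fin.snoc (α := fun _ => H) a b : Fin (n + 2) → H) i.castSucc.succ =
      a i.succ := fun i => by
    rw [← Fin.castSucc_succ, Fin.snoc_castSucc]
  simp only [h0, hl, hi, List.prod_singleton]

lemma generated (n : ℕ) : F.grade n =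
    Submodule.span k (Set.range fun a : Fin (n + 1) → H => form F.inH F.D a) := by
  apply le_antisymm
  · induction n with
    | zero =>
      intro x hx
      obtain ⟨h, rfl⟩ : ∃ h, F.inH h = x := by simpa [grade] using hx
      exact Submodule.subset_span ⟨fun _ => h, by simp [form]⟩
    | succ n ih =>
      have key : ∀ x ∈ F.grade n, ∀ b, x * F.D (F.inH b) ∈ Submodule.span k
          (Set.range fun a : Fin (n + 2) → H => form F.inH F.D a) := by
        intro x hx b
        refine Submodule.span_induction (p := fun x _ => x * F.D (F.inH b) ∈ _) ?_ ?_ ?_ ?_ (ih hx)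
        · rintro _ ⟨a, rfl⟩
          exact Submodule.subset_span ⟨_, (F.form_mul_D a b).symm⟩
        · simp
        · intro x y _ _ hx hy
          rw [add_mul]; exact add_mem hx hy
        · intro r x _ hx
          rw [smul_mul_assoc]; exact Submodule.smul_mem _ _ hx
      rw [grade_succ, Submodule.mul_le]
      rintro x hx _ ⟨γ, rfl⟩
      obtain ⟨t, rfl⟩ := F.adb_surjective γ
      induction t with
      | zero => simp
      | tmul a b =>
        rw [adb_tmul, inΓ_smul, ← mul_assoc, ← D_inH]
        refine key _ ?_ b
        have := SetLike.mul_mem_graded hx (F.inH_mem_grade a)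
        rwa [add_zero] at this
      | add u v hu hv => rw [map_add, map_add, mul_add]; exact add_mem hu hv
  · rw [Submodule.span_le]
    rintro _ ⟨a, rfl⟩
    induction n with
    | zero => simpa [form] using F.inH_mem_grade (a 0)
    | succ n ih =>
      have h := F.form_mul_D (Fin.init a) (a (Fin.last _))
      rw [Fin.snoc_init_self] at h
      simp only [← h]
      exact SetLike.mul_mem_graded (ih _) (F.D_mem_grade (F.inH_mem_grade _))

/-- `Γ^∧` is a differential calculus on `H`. -/
theorem isDifferentialCalculus : IsDifferentialCalculus F.inH F.grade F.D where
  graded := inferInstance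
  internal := DirectSum.Decomposition.isInternal F.grade
  d_mem _ _ hx := F.D_mem_grade hx
  d_d := F.D_D
  leibniz _ _ hx y := F.D_mul hx y
  incl_injective := F.inH_injective
  range_incl := by simp [grade]
  generated := F.generated

end MaxProlongCalculus
end FODC

namespace FODC
section Covariance

variable {k H Γ : Type*} [Field k] [Ring H] [HopfAlgebra k H] [AddCommGroup Γ] [Module k Γ]
  [Module H Γ] [Module Hᵐᵒᵖ Γ] [SMulCommClass H Hᵐᵒᵖ Γ] [IsScalarTower k H Γ]
  [IsScalarTower k Hᵐᵒᵖ Γ] (F : FODC k H Γ)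

/-- A left coaction of `H` on `Γ` that makes `(Γ, d)` left covariant. -/
structure LeftCovariant where
  coact : Γ →ₗ[k] H ⊗[k] Γ
  coassoc : ∀ ω, coact.lTensor H (coact ω) =
    TensorProduct.assoc k H H Γ ((Coalgebra.comul (R := k) (A := H)).rTensor Γ (coact ω))
  counit : ∀ ω, TensorProduct.lid k Γ
    ((Coalgebra.counit (R := k) (A := H)).rTensor Γ (coact ω)) = ω
  coact_smul : ∀ (h : H) ω, coact (h • ω) =
    TensorProduct.map₂ (LinearMap.mul k H) (lact k H Γ) (Coalgebra.comul h) (coact ω)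
  coact_op_smul : ∀ (h : H) ω, coact (MulOpposite.op h • ω) =
    TensorProduct.map₂ (LinearMap.mul k H).flip (ract k H Γ) (Coalgebra.comul h) (coact ω)
  coact_d : ∀ h, coact (F.d h) = F.d.lTensor H (Coalgebra.comul h)

/-- A right coaction of `H` on `Γ` that makes `(Γ, d)` right covariant. -/
structure RightCovariant where
  coact : Γ →ₗ[k] Γ ⊗[k] H
  coassoc : ∀ ω, TensorProduct.assoc k Γ H H (coact.rTensor H (coact ω)) =
    (Coalgebra.comul (R := k) (A := H)).lTensor Γ (coact ω)
  counit : ∀ ω, TensorProduct.rid k Γ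
    ((Coalgebra.counit (R := k) (A := H)).lTensor Γ (coact ω)) = ω
  coact_smul : ∀ (h : H) ω, coact (h • ω) =
    TensorProduct.map₂ (lact k H Γ) (LinearMap.mul k H) (Coalgebra.comul h) (coact ω)
  coact_op_smul : ∀ (h : H) ω, coact (MulOpposite.op h • ω) =
    TensorProduct.map₂ (ract k H Γ) (LinearMap.mul k H).flip (Coalgebra.comul h) (coact ω)
  coact_d : ∀ h, coact (F.d h) = F.d.rTensor H (Coalgebra.comul h)

/-- `(Γ, d)` is bicovariant: it is both left and right covariant. -/
structure Bicovariant where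
  left : F.LeftCovariant
  right : F.RightCovariant

/-! The involution `x ↦ (-1)^{|x|} x` of `Γ^∧` as an algebra morphism. -/

/-- The involution `x ↦ (-1)^{|x|} x` of `Γ^∧`. -/
def sgn : F.MaxProlong →ₐ[k] F.MaxProlong :=
  AlgHom.ofLinearMap (Matrix.entryLinearMap k F.MaxProlong 0 0 ∘ₗ F.dHom.toLinearMap)
    (by simp) (fun x y => by simpa using F.dHom_mul_zero_zero x y)

lemma sgn_of_mem {n : ℕ} {x : F.MaxProlong} (hx : x ∈ F.grade n) :
    F.sgn x = (-1 : k) ^ n • x := F.dHom_zero_zero hx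

lemma D_mul_sgn (x y : F.MaxProlong) : F.D (x * y) = F.D x * y + F.sgn x * F.D y :=
  F.D_mul' x y

lemma sgn_inH (h : H) : F.sgn (F.inH h) = F.inH h := by
  simpa using F.sgn_of_mem (F.inH_mem_grade h)

lemma sgn_inΓ (γ : Γ) : F.sgn (F.inΓ γ) = - F.inΓ γ := by
  simpa using F.sgn_of_mem (F.inΓ_mem_grade γ)

lemma map_D_mul {X : Type*} [Ring X] [Algebra k X] (u v : X ⊗[k] F.MaxProlong) :
    F.D.lTensor X (u * v) = F.D.lTensor X u * v +
      (F.sgn.toLinearMap.lTensor X u) * F.D.lTensor X v := by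
  induction u with
  | zero => simp
  | add u₁ u₂ h₁ h₂ => simp only [add_mul, map_add, h₁, h₂]; abel
  | tmul a x =>
    induction v with
    | zero => simp
    | add u₁ u₂ h₁ h₂ => simp only [mul_add, map_add, h₁, h₂]; abel
    | tmul b y => simp [D_mul_sgn, TensorProduct.tmul_add]

/-- The coproduct of `H` with values in `H ⊗ Γ^∧`. -/
def coactH : H →ₐ[k] H ⊗[k] F.MaxProlong :=
  (Algebra.TensorProduct.map (AlgHom.id k H) F.inH).comp (Bialgebra.comulAlgHom k H)

lemma coactH_apply (h : H) :
    F.coactH h = F.inH.toLinearMap.lTensor H (Coalgebra.comul h) := rfl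

namespace LeftCovariant

variable {F} (C : F.LeftCovariant)

/-- The coaction of `Γ` with values in `H ⊗ Γ^∧`. -/
def coactΓ : Γ →ₗ[k] H ⊗[k] F.MaxProlong := F.inΓ.lTensor H ∘ₗ C.coact

lemma coactΓ_apply (γ : Γ) : C.coactΓ γ = F.inΓ.lTensor H (C.coact γ) := rfl

lemma dadb_coactΓ (t : H ⊗[k] H) :
    F.dadb C.coactΓ t = F.d₁.lTensor H (C.coact (F.adb t)) := by
  induction t with
  | zero => simp
  | add x y hx hy => simp [hx, hy]
  | tmul a b =>
    rw [dadb_tmul, adb_tmul, C.coact_smul, coactΓ_apply, coactΓ_apply, coact_d, coact_d]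
    generalize Coalgebra.comul (R := k) a = s
    generalize Coalgebra.comul (R := k) b = t
    induction s with
    | zero => simp
    | add x y hx hy => simp only [map_add, add_mul, hx, hy, LinearMap.add_apply]
    | tmul a b =>
      induction t with
      | zero => simp
      | add x y hx hy => simp only [map_add, mul_add, hx, hy]
      | tmul a' b' => simp [d₁_smul, d₁_d]

/-- The left coaction of `H` on `Γ^∧`: the algebra morphism that extends the coproduct of `H` and
the coaction of `Γ`. -/
def coaction : F.MaxProlong →ₐ[k] H ⊗[k] F.MaxProlong :=
  F.lift F.coactH C.coactΓ
    (fun a γ => by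
      rw [coactΓ_apply, coactΓ_apply, C.coact_smul, coactH_apply]
      generalize Coalgebra.comul (R := k) a = s
      generalize C.coact γ = t
      induction s with
      | zero => simp
      | add x y hx hy => simp only [map_add, add_mul, hx, hy, LinearMap.add_apply]
      | tmul a b =>
        induction t with
        | zero => simp
        | add x y hx hy => simp only [map_add, mul_add, hx, hy]
        | tmul a' b' => simp [inΓ_smul])
    (fun a γ => by
      rw [coactΓ_apply, coactΓ_apply, C.coact_op_smul, coactH_apply]
      generalize Coalgebra.comul (R := k) a = s
      generalize C.coact γ = t
      induction s with
      | zero => simp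
      | add x y hx hy => simp only [map_add, mul_add, hx, hy, LinearMap.add_apply]
      | tmul a b =>
        induction t with
        | zero => simp
        | add x y hx hy => simp only [map_add, add_mul, hx, hy]
        | tmul a' b' => simp [inΓ_op_smul])
    (fun t ht => by rw [dadb_coactΓ, ht, map_zero, map_zero])

@[simp] lemma coaction_inH (h : H) :
    C.coaction (F.inH h) = F.inH.toLinearMap.lTensor H (Coalgebra.comul h) := by
  rw [coaction, lift_inH, coactH_apply]

@[simp] lemma coaction_inΓ (γ : Γ) : C.coaction (F.inΓ γ) = F.inΓ.lTensor H (C.coact γ) := by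
  rw [coaction, lift_inΓ, coactΓ_apply]

lemma coaction_coassoc (x : F.MaxProlong) :
    C.coaction.toLinearMap.lTensor H (C.coaction x) =
      TensorProduct.assoc k H H F.MaxProlong
        ((Coalgebra.comul (R := k) (A := H)).rTensor F.MaxProlong (C.coaction x)) := by
  have h : (Algebra.TensorProduct.map (AlgHom.id k H) C.coaction).comp C.coaction =
      (Algebra.TensorProduct.assoc k k k H H F.MaxProlong).toAlgHom.comp
        ((Algebra.TensorProduct.map (Bialgebra.comulAlgHom k H) (AlgHom.id k _)).comp
          C.coaction) := by
    refine F.algHom_ext (fun h => ?_) fun γ => ?_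
    · change C.coaction.toLinearMap.lTensor H (C.coaction (F.inH h)) =
        TensorProduct.assoc k H H F.MaxProlong
          ((Coalgebra.comul (R := k) (A := H)).rTensor F.MaxProlong (C.coaction (F.inH h)))
      rw [coaction_inH, ← LinearMap.comp_apply, ← LinearMap.lTensor_comp]
      have h₁ : C.coaction.toLinearMap ∘ₗ F.inH.toLinearMap =
          F.inH.toLinearMap.lTensor H ∘ₗ Coalgebra.comul := by
        ext; simp
      rw [h₁, LinearMap.lTensor_comp, LinearMap.comp_apply, ← Coalgebra.coassoc_apply]
      generalize Coalgebra.comul (R := k) h = s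
      induction s with
      | zero => simp
      | add x y hx hy => simp only [map_add, hx, hy]
      | tmul a b =>
        simp only [LinearMap.rTensor_tmul, LinearMap.lTensor_tmul, AlgHom.toLinearMap_apply]
        generalize Coalgebra.comul (R := k) a = s
        induction s with
        | zero => simp
        | add x y hx hy => simp only [map_add, TensorProduct.add_tmul, hx, hy]
        | tmul a' b' => simp
    · change C.coaction.toLinearMap.lTensor H (C.coaction (F.inΓ γ)) =
        TensorProduct.assoc k H H F.MaxProlong
          ((Coalgebra.comul (R := k) (A := H)).rTensor F.MaxProlong (C.coaction (F.inΓ γ)))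
      rw [coaction_inΓ, ← LinearMap.comp_apply, ← LinearMap.lTensor_comp]
      have h₁ : C.coaction.toLinearMap ∘ₗ F.inΓ = F.inΓ.lTensor H ∘ₗ C.coact := by
        ext; simp
      rw [h₁, LinearMap.lTensor_comp, LinearMap.comp_apply, C.coassoc]
      generalize C.coact γ = s
      induction s with
      | zero => simp
      | add x y hx hy => simp only [map_add, hx, hy]
      | tmul a b =>
        simp only [LinearMap.rTensor_tmul, LinearMap.lTensor_tmul]
        generalize Coalgebra.comul (R := k) a = s
        induction s with
        | zero => simp
        | add x y hx hy => simp only [map_add, TensorProduct.add_tmul, hx, hy]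
        | tmul a' b' => simp
  exact DFunLike.congr_fun h x

lemma coaction_counit (x : F.MaxProlong) :
    TensorProduct.lid k F.MaxProlong
      ((Coalgebra.counit (R := k) (A := H)).rTensor F.MaxProlong (C.coaction x)) = x := by
  have h : (Algebra.TensorProduct.lid k F.MaxProlong).toAlgHom.comp
      ((Algebra.TensorProduct.map (Bialgebra.counitAlgHom k H) (AlgHom.id k _)).comp
          C.coaction) = AlgHom.id k _ := by
    refine F.algHom_ext (fun h => ?_) fun γ => ?_
    · change TensorProduct.lid k F.MaxProlong
        ((Coalgebra.counit (R := k) (A := H)).rTensor F.MaxProlong (C.coaction (F.inH h))) = F.inH h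
      have h₁ : F.inH h = F.inH (TensorProduct.lid k H
          ((Coalgebra.counit (R := k) (A := H)).rTensor H (Coalgebra.comul h))) := by simp
      rw [coaction_inH]
      conv_rhs => rw [h₁]
      generalize Coalgebra.comul (R := k) h = s
      induction s with
      | zero => simp
      | add x y hx hy => simp only [map_add, hx, hy]
      | tmul a b => simp
    · change TensorProduct.lid k F.MaxProlong
        ((Coalgebra.counit (R := k) (A := H)).rTensor F.MaxProlong (C.coaction (F.inΓ γ))) = F.inΓ γ
      rw [coaction_inΓ]
      conv_rhs => rw [← C.counit γ]
      generalize C.coact γ = s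
      induction s with
      | zero => simp
      | add x y hx hy => simp only [map_add, hx, hy]
      | tmul a b => simp
  exact DFunLike.congr_fun h x

lemma coaction_sgn (x : F.MaxProlong) :
    C.coaction (F.sgn x) = F.sgn.toLinearMap.lTensor H (C.coaction x) := by
  have h : C.coaction.comp F.sgn =
      (Algebra.TensorProduct.map (AlgHom.id k H) F.sgn).comp C.coaction := by
    refine F.algHom_ext (fun h => ?_) fun γ => ?_
    · change C.coaction (F.sgn (F.inH h)) =
        F.sgn.toLinearMap.lTensor H (C.coaction (F.inH h))
      rw [sgn_inH, coaction_inH, ← LinearMap.comp_apply (F.sgn.toLinearMap.lTensor H), ← LinearMap.lTensor_comp]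
      congr 2
      ext; simp [sgn_inH]
    · change C.coaction (F.sgn (F.inΓ γ)) =
        F.sgn.toLinearMap.lTensor H (C.coaction (F.inΓ γ))
      rw [sgn_inΓ, map_neg, coaction_inΓ, ← LinearMap.comp_apply (F.sgn.toLinearMap.lTensor H), ← LinearMap.lTensor_comp]
      have : F.sgn.toLinearMap ∘ₗ F.inΓ = - F.inΓ := by ext; simp [sgn_inΓ]
      rw [this, LinearMap.lTensor_neg, LinearMap.neg_apply]
  exact DFunLike.congr_fun h x

/-- The differential is left colinear. -/
lemma coaction_D (x : F.MaxProlong) :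
    C.coaction (F.D x) = F.D.lTensor H (C.coaction x) := by
  induction x using F.induction with
  | inH h =>
    rw [D_inH, coaction_inΓ, C.coact_d, coaction_inH,
      ← LinearMap.comp_apply (F.inΓ.lTensor H),
      ← LinearMap.comp_apply (F.D.lTensor H), ← LinearMap.lTensor_comp, ← LinearMap.lTensor_comp]
    congr 2
    ext; simp [D_inH]
  | inΓ γ =>
    have h : F.D ∘ₗ F.inΓ = F.d₁ := by ext; simp [D_inΓ]
    rw [D_inΓ, coaction_inΓ, ← LinearMap.comp_apply (F.D.lTensor H), ← LinearMap.lTensor_comp, h]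
    obtain ⟨t, rfl⟩ := F.adb_surjective γ
    rw [d₁_adb, map_dadb, ← dadb_coactΓ]
    congr 2
    ext; simp [coactΓ_apply]
  | mul x y hx hy =>
    rw [D_mul_sgn, map_add, map_mul, map_mul, map_mul, map_D_mul, hx, hy, coaction_sgn]
  | add x y hx hy => simp only [map_add, hx, hy]

end LeftCovariant
end Covariance
end FODC

/-! ### Convolution and comodule algebras -/

section Convolution

variable {k H R R' : Type*} [Field k] [Ring H] [HopfAlgebra k H] [Ring R] [Algebra k R] [Ring R']
  [Algebra k R']

/-- The convolution product `h ↦ f(h₁) g(h₂)`. -/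
def conv (f g : H →ₗ[k] R) : H →ₗ[k] R :=
  LinearMap.mul' k R ∘ₗ TensorProduct.map f g ∘ₗ Coalgebra.comul

/-- The unit `h ↦ ε(h) 1` of the convolution product. -/
def convUnit (k H R : Type*) [Field k] [Ring H] [HopfAlgebra k H] [Ring R] [Algebra k R] :
    H →ₗ[k] R := Algebra.linearMap k R ∘ₗ Coalgebra.counit

lemma conv_apply (f g : H →ₗ[k] R) (h : H) :
    conv f g h = LinearMap.mul' k R (TensorProduct.map f g (Coalgebra.comul h)) := rfl

lemma conv_assoc (f g l : H →ₗ[k] R) : conv (conv f g) l = conv f (conv g l) :=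
  congrArg WithConv.ofConv (mul_assoc (WithConv.toConv f) (WithConv.toConv g) (WithConv.toConv l))

lemma conv_unit (f : H →ₗ[k] R) : conv f (convUnit k H R) = f :=
  congrArg WithConv.ofConv (mul_one (WithConv.toConv f))

lemma unit_conv (f : H →ₗ[k] R) : conv (convUnit k H R) f = f :=
  congrArg WithConv.ofConv (one_mul (WithConv.toConv f))

/-- The map `h ↦ φ(S(h))`. -/
def antip (φ : H →ₐ[k] R) : H →ₗ[k] R := φ.toLinearMap ∘ₗ HopfAlgebra.antipode k

lemma antip_apply (φ : H →ₐ[k] R) (h : H) : antip φ h = φ (HopfAlgebra.antipode k h) := rfl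

lemma comp_conv (φ : R →ₐ[k] R') (f g : H →ₗ[k] R) :
    φ.toLinearMap ∘ₗ conv f g = conv (φ.toLinearMap ∘ₗ f) (φ.toLinearMap ∘ₗ g) :=
  LinearMap.algHom_comp_convMul_distrib φ (WithConv.toConv f) (WithConv.toConv g)

lemma comp_convUnit (φ : R →ₐ[k] R') : φ.toLinearMap ∘ₗ convUnit k H R = convUnit k H R' := by
  ext; simp [convUnit]

lemma conv_antip (φ : H →ₐ[k] R) : conv φ.toLinearMap (antip φ) = convUnit k H R := by
  have h := congrArg WithConv.ofConv (LinearMap.id_mul_antipode (R := k) (C := H))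
  change conv LinearMap.id (HopfAlgebra.antipode k) = convUnit k H H at h
  rw [← comp_convUnit φ, ← h, comp_conv]
  rfl

lemma antip_conv (φ : H →ₐ[k] R) : conv (antip φ) φ.toLinearMap = convUnit k H R := by
  have h := congrArg WithConv.ofConv (LinearMap.antipode_mul_id (R := k) (C := H))
  change conv (HopfAlgebra.antipode k) LinearMap.id = convUnit k H H at h
  rw [← comp_convUnit φ, ← h, comp_conv]
  rfl

end Convolution

section ComoduleAlgebra

variable (k H A : Type*) [Field k] [Ring H] [HopfAlgebra k H] [Ring A] [Algebra k A]

/-- A right `H`-comodule algebra structure on `A`. -/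
structure ComoduleAlgebra where
  coact : A →ₐ[k] A ⊗[k] H
  coassoc : ∀ a, TensorProduct.assoc k A H H (coact.toLinearMap.rTensor H (coact a)) =
    (Coalgebra.comul (R := k) (A := H)).lTensor A (coact a)
  counit : ∀ a, TensorProduct.rid k A
    ((Coalgebra.counit (R := k) (A := H)).lTensor A (coact a)) = a

/-- The coproduct makes `H` a right comodule algebra over itself. -/
def regularComodule : ComoduleAlgebra k H H where
  coact := Bialgebra.comulAlgHom k H
  coassoc a := Coalgebra.coassoc_apply a
  counit a := by simp

variable {k H A} (δ : ComoduleAlgebra k H A) {R : Type*} [Ring R] [Algebra k R]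

namespace ComoduleAlgebra

/-- The map `a ↦ a₀ ⊗ f(a₁)`. -/
def push (f : H →ₗ[k] R) : A →ₗ[k] A ⊗[k] R := f.lTensor A ∘ₗ δ.coact.toLinearMap

lemma push_apply (f : H →ₗ[k] R) (a : A) : δ.push f a = f.lTensor A (δ.coact a) := rfl

/-- The algebra morphism `a ↦ a₀ ⊗ φ(a₁)`. -/
def pushHom (φ : H →ₐ[k] R) : A →ₐ[k] A ⊗[k] R :=
  (Algebra.TensorProduct.map (AlgHom.id k A) φ).comp δ.coact

lemma pushHom_apply (φ : H →ₐ[k] R) (a : A) : δ.pushHom φ a = δ.push φ.toLinearMap a := rfl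

lemma push_unit (a : A) : δ.push (convUnit k H R) a = a ⊗ₜ 1 := by
  have h : ∀ t : A ⊗[k] H, (convUnit k H R).lTensor A t =
      TensorProduct.rid k A ((Coalgebra.counit (R := k) (A := H)).lTensor A t) ⊗ₜ 1 := by
    intro t
    induction t with
    | zero => simp
    | tmul a h => simp [convUnit, Algebra.algebraMap_eq_smul_one, TensorProduct.smul_tmul]
    | add x y hx hy => simp [hx, hy, TensorProduct.add_tmul]
  rw [push_apply, h, δ.counit]

/-- The map `a ⊗ h ↦ F(a) (1 ⊗ g(h))`. -/
def twist (f : A →ₗ[k] A ⊗[k] R) (g : H →ₗ[k] R) : A ⊗[k] H →ₗ[k] A ⊗[k] R :=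
  LinearMap.mul' k (A ⊗[k] R) ∘ₗ
    TensorProduct.map f (Algebra.TensorProduct.includeRight.toLinearMap ∘ₗ g)

@[simp] lemma twist_tmul (f : A →ₗ[k] A ⊗[k] R) (g : H →ₗ[k] R) (a : A) (h : H) :
    twist f g (a ⊗ₜ h) = f a * (1 ⊗ₜ g h) := rfl

/-- Coassociativity: `a₀₀ ⊗ f(a₀₁) g(a₁) = a₀ ⊗ f(a₁₁) g(a₁₂)`. -/
lemma twist_push (f g : H →ₗ[k] R) (a : A) :
    twist (δ.push f) g (δ.coact a) = δ.push (conv f g) a := by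
  have h₁ : ∀ t : A ⊗[k] H, twist (δ.push f) g t =
      (LinearMap.mul' k R ∘ₗ TensorProduct.map f g).lTensor A
        (TensorProduct.assoc k A H H (δ.coact.toLinearMap.rTensor H t)) := by
    intro t
    induction t with
    | zero => simp
    | add x y hx hy => simp only [map_add, hx, hy]
    | tmul a h =>
      rw [twist_tmul, push_apply, LinearMap.rTensor_tmul, AlgHom.toLinearMap_apply]
      generalize δ.coact a = t
      induction t with
      | zero => simp
      | add x y hx hy => simp only [map_add, add_mul, TensorProduct.add_tmul, hx, hy]
      | tmul b g' => simp
  rw [h₁, δ.coassoc, ← LinearMap.comp_apply, ← LinearMap.lTensor_comp]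
  rfl

end ComoduleAlgebra
end ComoduleAlgebra

/-! ### Coinvariant forms -/

namespace FODC
namespace LeftCovariant
section Coinvariant

variable {k H Γ : Type*} [Field k] [Ring H] [HopfAlgebra k H] [AddCommGroup Γ] [Module k Γ]
  [Module H Γ] [Module Hᵐᵒᵖ Γ] [SMulCommClass H Hᵐᵒᵖ Γ] [IsScalarTower k H Γ]
  [IsScalarTower k Hᵐᵒᵖ Γ] {F : FODC k H Γ} (C : F.LeftCovariant)

/-- The map `h ⊗ ω ↦ S(h) ω`. -/
def antipMul (F : FODC k H Γ) : H ⊗[k] F.MaxProlong →ₗ[k] F.MaxProlong :=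
  LinearMap.mul' k F.MaxProlong ∘ₗ
    TensorProduct.map (antip F.inH) LinearMap.id

@[simp] lemma antipMul_tmul (h : H) (ω : F.MaxProlong) :
    antipMul F (h ⊗ₜ ω) = F.inH (HopfAlgebra.antipode k h) * ω := rfl

/-- The map `ω ↦ S(ω₋₁) ω₀` from `Γ^∧` to `Γ^∧`. -/
def invProj : F.MaxProlong →ₗ[k] F.MaxProlong := antipMul F ∘ₗ C.coaction.toLinearMap

lemma invProj_apply (ω : F.MaxProlong) : C.invProj ω = antipMul F (C.coaction ω) := rfl

/-- The map `h ⊗ ω ↦ h₁ ⊗ h₂ ω`. -/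
def comulMul (F : FODC k H Γ) : H ⊗[k] F.MaxProlong →ₗ[k] H ⊗[k] F.MaxProlong :=
  LinearMap.mul' k _ ∘ₗ TensorProduct.map F.coactH.toLinearMap
    Algebra.TensorProduct.includeRight.toLinearMap

@[simp] lemma comulMul_tmul (h : H) (ω : F.MaxProlong) :
    comulMul F (h ⊗ₜ ω) = F.coactH h * (1 ⊗ₜ ω) := rfl

lemma comulMul_antip (h : H) : ComoduleAlgebra.twist F.coactH.toLinearMap (antip F.inH)
    (Coalgebra.comul h) = h ⊗ₜ 1 := by
  have := (regularComodule k H).twist_push F.inH.toLinearMap (antip F.inH) h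
  rw [conv_antip, ComoduleAlgebra.push_unit] at this
  exact this

lemma comulMul_invProj (ω : F.MaxProlong) :
    comulMul F (C.invProj.lTensor H (C.coaction ω)) = C.coaction ω := by
  have h₁ : C.invProj.lTensor H (C.coaction ω) = (antipMul F).lTensor H
      (C.coaction.toLinearMap.lTensor H (C.coaction ω)) := by
    rw [← LinearMap.comp_apply (LinearMap.lTensor _ _), ← LinearMap.lTensor_comp]; rfl
  rw [h₁, coaction_coassoc]
  generalize C.coaction ω = t
  induction t with
  | zero => simp
  | add x y hx hy => simp only [map_add, hx, hy]
  | tmul h ω =>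
    have h₂ : ∀ s : H ⊗[k] H, comulMul F ((antipMul F).lTensor H
        (TensorProduct.assoc k H H F.MaxProlong (s ⊗ₜ ω))) =
        ComoduleAlgebra.twist F.coactH.toLinearMap (antip F.inH) s * (1 ⊗ₜ ω) := by
      intro s
      induction s with
      | zero => simp
      | add x y hx hy => simp only [map_add, TensorProduct.add_tmul, add_mul, hx, hy]
      | tmul a b => simp [antip_apply, mul_assoc]
    rw [LinearMap.rTensor_tmul, h₂, comulMul_antip]
    simp

lemma coaction_antipMul (t : H ⊗[k] F.MaxProlong) : C.coaction (antipMul F t) =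
    LinearMap.mul' k _ (TensorProduct.map (antip F.coactH) C.coaction.toLinearMap t) := by
  induction t with
  | zero => simp
  | add x y hx hy => simp only [map_add, hx, hy]
  | tmul h ω =>
    simp [antip_apply, coactH_apply]

/-- The element `S(ω₋₁) ω₀` is left coinvariant. -/
lemma coaction_invProj (ω : F.MaxProlong) : C.coaction (C.invProj ω) = 1 ⊗ₜ C.invProj ω := by
  have h₁ : C.coaction.toLinearMap = comulMul F ∘ₗ C.invProj.lTensor H ∘ₗ C.coaction.toLinearMap :=
    LinearMap.ext fun ω => (C.comulMul_invProj ω).symm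
  have h₂ : ∀ t : H ⊗[k] F.MaxProlong,
      TensorProduct.map (antip F.coactH) C.coaction.toLinearMap t =
      TensorProduct.map (antip F.coactH) (comulMul F ∘ₗ C.invProj.lTensor H)
        (C.coaction.toLinearMap.lTensor H t) := by
    intro t
    conv_lhs => rw [h₁]
    induction t with
    | zero => simp
    | add x y hx hy => simp only [map_add, hx, hy]
    | tmul h ω => simp
  rw [invProj_apply, coaction_antipMul, h₂, coaction_coassoc, ← invProj_apply]
  conv_rhs => rw [← C.coaction_counit ω]
  generalize C.coaction ω = t
  induction t with
  | zero => simp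
  | add x y hx hy => simp only [map_add, TensorProduct.tmul_add, hx, hy]
  | tmul h ω =>
    have h₃ : ∀ s : H ⊗[k] H, LinearMap.mul' k (H ⊗[k] F.MaxProlong)
        (TensorProduct.map (antip F.coactH) (comulMul F ∘ₗ C.invProj.lTensor H)
        (TensorProduct.assoc k H H F.MaxProlong (s ⊗ₜ ω))) =
        LinearMap.mul' k _ (TensorProduct.map (antip F.coactH) F.coactH.toLinearMap s) *
          (1 ⊗ₜ C.invProj ω) := by
      intro s
      induction s with
      | zero => simp
      | add x y hx hy => simp only [map_add, TensorProduct.add_tmul, add_mul, hx, hy]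
      | tmul a b => simp [mul_assoc]
    rw [LinearMap.rTensor_tmul, h₃, ← conv_apply, antip_conv]
    simp [convUnit, Algebra.algebraMap_eq_smul_one]

/-- The algebra `Λ` of left coinvariant forms. -/
def Lam : Subalgebra k F.MaxProlong :=
  AlgHom.equalizer C.coaction Algebra.TensorProduct.includeRight

lemma mem_Lam {ω : F.MaxProlong} : ω ∈ C.Lam ↔ C.coaction ω = 1 ⊗ₜ ω := Iff.rfl

/-- The left coinvariant forms of degree `n`. -/
def LamGrade (n : ℕ) : Submodule k C.Lam := (F.grade n).comap C.Lam.val.toLinearMap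

lemma mem_LamGrade {n : ℕ} {θ : C.Lam} : θ ∈ C.LamGrade n ↔ (θ : F.MaxProlong) ∈ F.grade n := Iff.rfl

/-- The map `π_inv : Γ^∧ → Λ`, `ω ↦ S(ω₋₁) ω₀`. -/
def piInv : F.MaxProlong →ₗ[k] C.Lam :=
  C.invProj.codRestrict (Subalgebra.toSubmodule C.Lam) C.coaction_invProj

@[simp] lemma coe_piInv (ω : F.MaxProlong) : (C.piInv ω : F.MaxProlong) = antipMul F (C.coaction ω) :=
  rfl

/-- The bilinear map `(θ, h) ↦ S(h₁) θ h₂`. -/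
def hookFun (F : FODC k H Γ) : F.MaxProlong →ₗ[k] H →ₗ[k] F.MaxProlong :=
  (LinearMap.lcomp k F.MaxProlong (Coalgebra.comul (R := k) (A := H))) ∘ₗ
    LinearMap.mk₂ k (fun θ t => LinearMap.mul' k F.MaxProlong
        (TensorProduct.map (antip F.inH) (LinearMap.mulLeft k θ ∘ₗ F.inH.toLinearMap) t))
      (fun m n t => by
        induction t with
        | zero => simp
        | add x y hx hy => simp only [map_add, hx, hy]; abel
        | tmul a b => simp [mul_add, add_mul])
      (fun r m t => by
        induction t with
        | zero => simp
        | add x y hx hy => simp only [map_add, hx, hy, smul_add]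
        | tmul a b => simp)
      (fun m t s => by simp)
      (fun r m t => by simp)

lemma hookFun_eq (θ : F.MaxProlong) : hookFun F θ =
    conv (antip F.inH) (LinearMap.mulLeft k θ ∘ₗ F.inH.toLinearMap) := rfl

lemma antipMul_mul (t : H ⊗[k] F.MaxProlong) (ω : F.MaxProlong) :
    antipMul F (t * (1 ⊗ₜ ω)) = antipMul F t * ω := by
  induction t with
  | zero => simp
  | add x y hx hy => simp only [map_add, add_mul, hx, hy]
  | tmul h ω => simp [mul_assoc]

lemma hookFun_apply {θ : F.MaxProlong} (hθ : θ ∈ C.Lam) (h : H) :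
    hookFun F θ h = C.invProj (θ * F.inH h) := by
  rw [hookFun_eq, conv_apply, invProj_apply, map_mul, C.mem_Lam.1 hθ, coaction_inH]
  generalize Coalgebra.comul (R := k) h = s
  induction s with
  | zero => simp
  | add x y hx hy => simp only [map_add, mul_add, hx, hy]
  | tmul a b => simp [antip_apply]

/-- The right action `θ ↼ h = S(h₁) θ h₂` of `H` on `Λ`. -/
def hook : C.Lam →ₗ[k] H →ₗ[k] C.Lam :=
  LinearMap.mk₂ k (fun θ h => ⟨hookFun F θ h, by
      rw [C.hookFun_apply θ.2]; exact C.coaction_invProj _⟩)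
    (fun _ _ _ => Subtype.ext (by simp))
    (fun _ _ _ => Subtype.ext (by simp))
    (fun _ _ _ => Subtype.ext (by simp))
    (fun _ _ _ => Subtype.ext (by simp))

lemma coe_hook (θ : C.Lam) (h : H) : (C.hook θ h : F.MaxProlong) = hookFun F θ h := rfl

/-- The restriction of the differential to `Λ`. -/
def dLam : C.Lam →ₗ[k] C.Lam :=
  (F.D ∘ₗ C.Lam.val.toLinearMap).codRestrict (Subalgebra.toSubmodule C.Lam) fun θ => by
    have h : C.coaction θ = 1 ⊗ₜ (θ : F.MaxProlong) := θ.2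
    change C.coaction (F.D θ) = _
    rw [coaction_D, h]
    rfl

@[simp] lemma coe_dLam (θ : C.Lam) : (C.dLam θ : F.MaxProlong) = F.D θ := rfl

lemma invProj_D_inH (h : H) :
    C.invProj (F.D (F.inH h)) = conv (antip F.inH) (F.D ∘ₗ F.inH.toLinearMap) h := by
  rw [invProj_apply, coaction_D, coaction_inH, conv_apply]
  generalize Coalgebra.comul (R := k) h = s
  induction s with
  | zero => simp
  | add x y hx hy => simp only [map_add, hx, hy]
  | tmul a b => simp [antip_apply]

/-- The Maurer-Cartan form `ϖ(h) = S(h₁) dh₂`. -/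
def maurerCartan : H →ₗ[k] C.Lam :=
  (conv (antip F.inH) (F.D ∘ₗ F.inH.toLinearMap)).codRestrict (Subalgebra.toSubmodule C.Lam)
    fun h => by rw [← C.invProj_D_inH]; exact C.coaction_invProj _

lemma coe_maurerCartan (h : H) : (C.maurerCartan h : F.MaxProlong) =
    conv (antip F.inH) (F.D ∘ₗ F.inH.toLinearMap) h := rfl

/-- The map `π_ε(h) = h - ε(h) 1`. -/
def piEps (k H : Type*) [Field k] [Ring H] [HopfAlgebra k H] : H →ₗ[k] H :=
  LinearMap.id - convUnit k H H

lemma maurerCartan_piEps (h : H) : C.maurerCartan (piEps k H h) = C.maurerCartan h := by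
  have h₁ : C.maurerCartan 1 = 0 := by
    have h₀ : F.D 1 = 0 := by rw [← map_one F.inH, D_inH, d_one, map_zero]
    apply Subtype.ext
    simp [coe_maurerCartan, conv_apply, Algebra.TensorProduct.one_def, h₀]
  simp [piEps, convUnit, Algebra.algebraMap_eq_smul_one, h₁]

/-- `h₁ (θ ↼ h₂) = θ h`. -/
lemma conv_hookFun (θ : F.MaxProlong) : conv F.inH.toLinearMap (hookFun F θ) =
    LinearMap.mulLeft k θ ∘ₗ F.inH.toLinearMap := by
  rw [hookFun_eq, ← conv_assoc, conv_antip, unit_conv]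

/-- `h₁ ϖ(h₂) = dh`. -/
lemma conv_maurerCartan : conv F.inH.toLinearMap (C.Lam.val.toLinearMap ∘ₗ C.maurerCartan) =
    F.D ∘ₗ F.inH.toLinearMap := by
  have : C.Lam.val.toLinearMap ∘ₗ C.maurerCartan =
      conv (antip F.inH) (F.D ∘ₗ F.inH.toLinearMap) := rfl
  rw [this, ← conv_assoc, conv_antip, unit_conv]

end Coinvariant
end LeftCovariant
end FODC

/-! ### Quantum principal bundles -/

section BalancedTensor

variable (B X Y Z M : Type*) [Ring B] [AddCommGroup X] [Module Bᵐᵒᵖ X] [AddCommGroup Y]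
  [Module Bᵐᵒᵖ Y] [AddCommGroup Z] [Module Bᵐᵒᵖ Z] [AddCommGroup M] [Module B M]

/-- The relations `x b ⊗ m = x ⊗ b m`. -/
def balancedRel : AddSubgroup (X ⊗[ℤ] M) :=
  AddSubgroup.closure {t | ∃ (x : X) (b : B) (m : M),
    t = (MulOpposite.op b • x) ⊗ₜ[ℤ] m - x ⊗ₜ[ℤ] (b • m)}

/-- The tensor product `X ⊗_B M` of a right and a left module over a noncommutative ring. -/
abbrev BalancedTensor : Type _ := (X ⊗[ℤ] M) ⧸ balancedRel B X M

variable {B X Y Z}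

/-- The map `f ⊗_B id`. -/
def balancedMap (f : X →ₗ[Bᵐᵒᵖ] Y) : BalancedTensor B X M →+ BalancedTensor B Y M :=
  QuotientAddGroup.map (balancedRel B X M) (balancedRel B Y M)
    (f.toAddMonoidHom.toIntLinearMap.rTensor M).toAddMonoidHom (by
    rw [balancedRel, AddSubgroup.closure_le]
    rintro _ ⟨x, b, m, rfl⟩
    refine AddSubgroup.subset_closure ⟨f x, b, m, ?_⟩
    rw [← map_smul f]
    exact map_sub _ _ _)

/-- The sequence `0 → X → Y → Z → 0` is exact. -/
def IsShortExact {P Q R : Type*} [Zero R] (f : P → Q) (g : Q → R) : Prop :=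
  Function.Injective f ∧ (∀ y, g y = 0 ↔ y ∈ Set.range f) ∧ Function.Surjective g

end BalancedTensor

universe u v

/-- The left `B`-module `M` is faithfully flat: a sequence `0 → X → Y → Z → 0` of right `B`-modules
is exact if and only if `0 → X ⊗_B M → Y ⊗_B M → Z ⊗_B M → 0` is. -/
def IsFaithfullyFlat (B : Type u) (M : Type v) [Ring B] [AddCommGroup M] [Module B M] : Prop :=
  ∀ (X Y Z : Type u) [AddCommGroup X] [Module Bᵐᵒᵖ X] [AddCommGroup Y] [Module Bᵐᵒᵖ Y]
    [AddCommGroup Z] [Module Bᵐᵒᵖ Z] (f : X →ₗ[Bᵐᵒᵖ] Y) (g : Y →ₗ[Bᵐᵒᵖ] Z),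
    IsShortExact f g ↔ IsShortExact (balancedMap M f) (balancedMap M g)

namespace ComoduleAlgebra
section Bundle

variable {k H A : Type*} [Field k] [Ring H] [HopfAlgebra k H] [Ring A] [Algebra k A]
  (δ : ComoduleAlgebra k H A)

/-- The algebra `B = A^{co H}` of coinvariants. -/
def coinv : Subalgebra k A := AlgHom.equalizer δ.coact Algebra.TensorProduct.includeLeft

/-- Right multiplication makes `A` a right module over the coinvariants. -/
instance : Module δ.coinvᵐᵒᵖ A := Module.compHom A (RingHom.op δ.coinv.val.toRingHom)

lemma op_smul_eq (b : δ.coinv) (a : A) : MulOpposite.op b • a = a * (b : A) := rfl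

/-- The canonical map `χ : A ⊗_B A → A ⊗ H`, `a ⊗ a' ↦ a a'₀ ⊗ a'₁`. -/
def canonicalMap : BalancedTensor δ.coinv A A →+ A ⊗[k] H :=
  QuotientAddGroup.lift (balancedRel δ.coinv A A)
    (TensorProduct.lift (LinearMap.mk₂ ℤ (fun a a' => (a ⊗ₜ[k] (1 : H)) * δ.coact a')
      (fun _ _ _ => by rw [TensorProduct.add_tmul, add_mul])
      (fun _ _ _ => by rw [← smul_mul_assoc, TensorProduct.smul_tmul'])
      (fun _ _ _ => by rw [map_add, mul_add])
      (fun _ _ _ => by rw [map_zsmul, mul_smul_comm]))).toAddMonoidHom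
    (by
      rw [balancedRel, AddSubgroup.closure_le]
      rintro _ ⟨x, b, m, rfl⟩
      have hb : δ.coact b = (b : A) ⊗ₜ 1 := b.2
      rw [SetLike.mem_coe, AddMonoidHom.mem_ker, map_sub, sub_eq_zero, LinearMap.toAddMonoidHom_coe,
        TensorProduct.lift.tmul, TensorProduct.lift.tmul, LinearMap.mk₂_apply, LinearMap.mk₂_apply,
        op_smul_eq, Subalgebra.smul_def, smul_eq_mul, map_mul, hb, ← mul_assoc,
        Algebra.TensorProduct.tmul_mul_tmul, one_mul])

/-- The comodule algebra `A` is a quantum principal bundle: a faithfully flat Hopf-Galois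
extension of the algebra of its coinvariants. -/
structure IsQuantumPrincipalBundle : Prop where
  hopfGalois : Function.Bijective δ.canonicalMap
  faithfullyFlat : IsFaithfullyFlat δ.coinv A

end Bundle
end ComoduleAlgebra

/-! ### Vertical forms -/

section Vertical

variable {k H A Γ : Type*} [Field k] [Ring H] [HopfAlgebra k H] [Ring A] [Algebra k A]
  [AddCommGroup Γ] [Module k Γ] [Module H Γ] [Module Hᵐᵒᵖ Γ] [SMulCommClass H Hᵐᵒᵖ Γ]
  [IsScalarTower k H Γ] [IsScalarTower k Hᵐᵒᵖ Γ] {F : FODC k H Γ} (δ : ComoduleAlgebra k H A)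
  (C : F.LeftCovariant)

/-- The vertical forms `A ⊗ Λ`. -/
def Ver (_ : ComoduleAlgebra k H A) (C : F.LeftCovariant) : Type _ := A ⊗[k] C.Lam

namespace Ver

instance : AddCommGroup (Ver δ C) := inferInstanceAs (AddCommGroup (A ⊗[k] C.Lam))

instance : Module k (Ver δ C) := inferInstanceAs (Module k (A ⊗[k] C.Lam))

/-- The identification of `A ⊗ Λ` with the vertical forms. -/
def of : A ⊗[k] C.Lam ≃ₗ[k] Ver δ C := LinearEquiv.refl k _

/-- The bilinear map `(x, η) ↦ x (1 ⊗ η)`. -/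
def mulLam : A ⊗[k] C.Lam →ₗ[k] C.Lam →ₗ[k] A ⊗[k] C.Lam :=
  LinearMap.flip (LinearMap.lTensorHom A ∘ₗ (LinearMap.mul k C.Lam).flip)

@[simp] lemma mulLam_tmul (a : A) (θ η : C.Lam) : mulLam C (a ⊗ₜ[k] θ) η = a ⊗ₜ (θ * η) := rfl

/-- The product `(a ⊗ θ) ∧ (b ⊗ η) = a b₀ ⊗ (θ ↼ b₁) ∧ η` of vertical forms. -/
def vmul : A ⊗[k] C.Lam →ₗ[k] A ⊗[k] C.Lam →ₗ[k] A ⊗[k] C.Lam :=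
  LinearMap.mk₂ k (fun x y => TensorProduct.lift
      (mulLam C ∘ₗ TensorProduct.map₂ (LinearMap.mul k A) C.hook x ∘ₗ δ.coact.toLinearMap) y)
    (fun x x' y => by
      induction y with
      | zero => simp
      | tmul b η => simp
      | add y y' h h' => rw [map_add _ y y', map_add _ y y', map_add _ y y', h, h']; abel)
    (fun r x y => by
      induction y with
      | zero => simp
      | tmul b η => simp
      | add y y' h h' => rw [map_add _ y y', map_add _ y y', smul_add, h, h'])
    (fun x y y' => map_add _ y y')
    (fun r x y => map_smul _ r y)

lemma vmul_tmul (x : A ⊗[k] C.Lam) (b : A) (η : C.Lam) : vmul δ C x (b ⊗ₜ η) =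
    mulLam C (TensorProduct.map₂ (LinearMap.mul k A) C.hook x (δ.coact b)) η := rfl

/-- The inclusion of `A ⊗ Λ` in `A ⊗ Γ^∧`. -/
def incl : Ver δ C →ₗ[k] A ⊗[k] F.MaxProlong := C.Lam.val.toLinearMap.lTensor A

lemma incl_tmul (a : A) (θ : C.Lam) : incl δ C (of δ C (a ⊗ₜ θ)) = a ⊗ₜ (θ : F.MaxProlong) := rfl

lemma incl_injective : Function.Injective (incl δ C) :=
  Module.Flat.lTensor_preserves_injective_linearMap _ Subtype.val_injective

/-- The map `a ⊗ θ ↦ a₀ ⊗ a₁ θ`, which will be a morphism of differential graded algebras. -/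
def emb : Ver δ C →ₗ[k] A ⊗[k] F.MaxProlong :=
  LinearMap.mul' k _ ∘ₗ TensorProduct.map (δ.pushHom F.inH).toLinearMap
    (Algebra.TensorProduct.includeRight.toLinearMap ∘ₗ C.Lam.val.toLinearMap)

lemma emb_tmul (a : A) (θ : C.Lam) :
    emb δ C (of δ C (a ⊗ₜ θ)) = δ.pushHom F.inH a * (1 ⊗ₜ (θ : F.MaxProlong)) := rfl

/-- The map `a ⊗ ω ↦ a₀ ⊗ S(a₁) ω`. -/
def embInv (F : FODC k H Γ) : A ⊗[k] F.MaxProlong →ₗ[k] A ⊗[k] F.MaxProlong :=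
  LinearMap.mul' k _ ∘ₗ TensorProduct.map (δ.push (antip F.inH))
    Algebra.TensorProduct.includeRight.toLinearMap

lemma embInv_push (f : H →ₗ[k] F.MaxProlong) (a : A) (ω : F.MaxProlong) :
    embInv δ F (δ.push f a * (1 ⊗ₜ ω)) = δ.push (conv (antip F.inH) f) a * (1 ⊗ₜ ω) := by
  rw [← ComoduleAlgebra.twist_push, ComoduleAlgebra.push_apply δ f]
  generalize δ.coact a = t
  induction t with
  | zero => simp
  | add x y hx hy => simp only [map_add, add_mul, hx, hy]
  | tmul b h => simp [embInv, mul_assoc]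

lemma embInv_emb (x : Ver δ C) : embInv δ F (emb δ C x) = incl δ C x := by
  obtain ⟨x, rfl⟩ := (of δ C).surjective x
  induction x with
  | zero => simp
  | add x y hx hy => simp only [map_add, hx, hy]
  | tmul a θ =>
    rw [emb_tmul, ComoduleAlgebra.pushHom_apply, embInv_push, antip_conv,
      ComoduleAlgebra.push_unit, incl_tmul]
    simp

lemma emb_injective : Function.Injective (emb δ C) := fun x y h =>
  incl_injective δ C (by rw [← embInv_emb, ← embInv_emb, h])

lemma push_hook (θ : C.Lam) (b : A) :
    δ.push (conv F.inH.toLinearMap (FODC.LeftCovariant.hookFun F θ)) b =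
      (1 ⊗ₜ (θ : F.MaxProlong)) * δ.pushHom F.inH b := by
  rw [FODC.LeftCovariant.conv_hookFun, ComoduleAlgebra.pushHom_apply, ComoduleAlgebra.push_apply,
    ComoduleAlgebra.push_apply]
  generalize δ.coact b = t
  induction t with
  | zero => simp
  | add x y hx hy => simp only [map_add, mul_add, hx, hy]
  | tmul b h => simp

lemma emb_vmul (x y : A ⊗[k] C.Lam) : emb δ C (of δ C (vmul δ C x y)) =
    emb δ C (of δ C x) * emb δ C (of δ C y) := by
  induction x with
  | zero => simp
  | add x y hx hy => simp only [map_add, LinearMap.add_apply, add_mul, hx, hy]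
  | tmul a θ =>
  induction y with
  | zero => simp
  | add x y hx hy => simp only [map_add, mul_add, hx, hy]
  | tmul b η =>
    have h : emb δ C (of δ C (vmul δ C (a ⊗ₜ θ) (b ⊗ₜ η))) =
        δ.pushHom F.inH a * ComoduleAlgebra.twist (δ.pushHom F.inH).toLinearMap
          (FODC.LeftCovariant.hookFun F θ) (δ.coact b) * (1 ⊗ₜ (η : F.MaxProlong)) := by
      rw [vmul_tmul]
      generalize δ.coact b = t
      induction t with
      | zero => simp
      | add x y hx hy => simp only [map_add, add_mul, mul_add, LinearMap.add_apply, hx, hy]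
      | tmul b h =>
        rw [TensorProduct.map₂_apply_tmul, TensorProduct.map_tmul, mulLam_tmul, emb_tmul]
        simp [mul_assoc, FODC.LeftCovariant.coe_hook]
    have h' := δ.twist_push F.inH.toLinearMap (FODC.LeftCovariant.hookFun F θ) b
    rw [push_hook] at h'
    rw [h, emb_tmul, emb_tmul, mul_assoc, mul_assoc, ← mul_assoc _ (δ.pushHom F.inH b), ← h']
    rfl

instance : Mul (Ver δ C) where mul x y := of δ C (vmul δ C ((of δ C).symm x) ((of δ C).symm y))

instance : One (Ver δ C) where one := of δ C (1 ⊗ₜ 1)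

lemma mul_def (x y : A ⊗[k] C.Lam) : of δ C x * of δ C y = of δ C (vmul δ C x y) := rfl

lemma one_def : (1 : Ver δ C) = of δ C (1 ⊗ₜ 1) := rfl

lemma emb_mul (x y : Ver δ C) : emb δ C (x * y) = emb δ C x * emb δ C y := emb_vmul δ C _ _

lemma emb_one : emb δ C 1 = 1 := by
  rw [one_def, emb_tmul, map_one, one_mul]; rfl

instance : Ring (Ver δ C) where
  left_distrib x y z := emb_injective δ C (by simp only [emb_mul, map_add, mul_add])
  right_distrib x y z := emb_injective δ C (by simp only [emb_mul, map_add, add_mul])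
  zero_mul x := emb_injective δ C (by simp only [emb_mul, map_zero, zero_mul])
  mul_zero x := emb_injective δ C (by simp only [emb_mul, map_zero, mul_zero])
  mul_assoc x y z := emb_injective δ C (by simp only [emb_mul, mul_assoc])
  one_mul x := emb_injective δ C (by simp only [emb_mul, emb_one, one_mul])
  mul_one x := emb_injective δ C (by simp only [emb_mul, emb_one, mul_one])
  zsmul := zsmulRec
  neg_add_cancel := neg_add_cancel
  sub_eq_add_neg := sub_eq_add_neg

instance : Algebra k (Ver δ C) :=
  Algebra.ofModule
    (fun r x y => emb_injective δ C (by simp only [emb_mul, map_smul, smul_mul_assoc]))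
    (fun r x y => emb_injective δ C (by simp only [emb_mul, map_smul, mul_smul_comm]))

/-- The inclusion `a ↦ a ⊗ 1` of `A` in the vertical forms. -/
def inA : A →ₐ[k] Ver δ C :=
  AlgHom.ofLinearMap ((of δ C).toLinearMap ∘ₗ (TensorProduct.mk k A C.Lam).flip 1) rfl
    (fun a b => emb_injective δ C (by
      rw [emb_mul]
      change emb δ C (of δ C (_ ⊗ₜ _)) = emb δ C (of δ C (_ ⊗ₜ _)) * emb δ C (of δ C (_ ⊗ₜ _))
      simp only [emb_tmul, map_mul]
      simp [← Algebra.TensorProduct.one_def]))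

lemma inA_apply (a : A) : inA δ C a = of δ C (a ⊗ₜ 1) := rfl

/-- The differential `d(a ⊗ θ) = a ⊗ dθ + a₀ ⊗ ϖ(π_ε(a₁)) ∧ θ` of vertical forms. -/
def D : Ver δ C →ₗ[k] Ver δ C :=
  (of δ C).toLinearMap ∘ₗ
    (C.dLam.lTensor A + TensorProduct.lift
      (mulLam C ∘ₗ (C.maurerCartan ∘ₗ FODC.LeftCovariant.piEps k H).lTensor A ∘ₗ
        δ.coact.toLinearMap)) ∘ₗ (of δ C).symm.toLinearMap

/-- The vertical forms `A ⊗ Λⁿ` of degree `n`. -/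
def grade (n : ℕ) : Submodule k (Ver δ C) :=
  (LinearMap.range ((C.LamGrade n).subtype.lTensor A)).map (of δ C).toLinearMap

lemma D_tmul (a : A) (θ : C.Lam) : D δ C (of δ C (a ⊗ₜ θ)) = of δ C (a ⊗ₜ C.dLam θ) +
    of δ C (mulLam C ((C.maurerCartan ∘ₗ FODC.LeftCovariant.piEps k H).lTensor A (δ.coact a)) θ) :=
  rfl

lemma emb_D (x : Ver δ C) : emb δ C (D δ C x) = F.D.lTensor A (emb δ C x) := by
  obtain ⟨x, rfl⟩ := (of δ C).surjective x
  induction x with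
  | zero => simp
  | add x y hx hy => simp only [map_add, hx, hy]
  | tmul a θ =>
    have h₁ : C.maurerCartan ∘ₗ FODC.LeftCovariant.piEps k H = C.maurerCartan :=
      LinearMap.ext C.maurerCartan_piEps
    have h₂ : ∀ t : A ⊗[k] H, emb δ C (of δ C (mulLam C (C.maurerCartan.lTensor A t) θ)) =
        ComoduleAlgebra.twist (δ.pushHom F.inH).toLinearMap
          (C.Lam.val.toLinearMap ∘ₗ C.maurerCartan) t * (1 ⊗ₜ (θ : F.MaxProlong)) := by
      intro t
      induction t with
      | zero => simp
      | add x y hx hy => simp only [map_add, add_mul, LinearMap.add_apply, hx, hy]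
      | tmul a h =>
        rw [LinearMap.lTensor_tmul, mulLam_tmul, emb_tmul]
        simp [mul_assoc]
    have h₃ := δ.twist_push F.inH.toLinearMap (C.Lam.val.toLinearMap ∘ₗ C.maurerCartan) a
    rw [C.conv_maurerCartan] at h₃
    have h₄ : F.D.lTensor A (δ.pushHom F.inH a) = δ.push (F.D ∘ₗ F.inH.toLinearMap) a := by
      rw [ComoduleAlgebra.pushHom_apply, ComoduleAlgebra.push_apply, ComoduleAlgebra.push_apply,
        LinearMap.lTensor_comp, LinearMap.comp_apply]
    have h₅ : F.sgn.toLinearMap.lTensor A (δ.pushHom F.inH a) = δ.pushHom F.inH a := by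
      rw [ComoduleAlgebra.pushHom_apply, ComoduleAlgebra.push_apply]
      generalize δ.coact a = t
      induction t with
      | zero => simp
      | add x y hx hy => simp only [map_add, hx, hy]
      | tmul a h => simp [FODC.sgn_inH]
    rw [D_tmul, h₁, map_add, h₂, emb_tmul, emb_tmul, F.map_D_mul, h₄, h₅, ← h₃, add_comm]
    rfl

end Ver
end Vertical

section Internal

variable {k M : Type*} [Field k] [AddCommGroup M] [Module k M]

lemma isInternal_of_proj (N : ℕ → Submodule k M) (p : ℕ → M →ₗ[k] M)
    (hs : ∀ n, ∀ x ∈ N n, p n x = x) (hz : ∀ m n, m ≠ n → ∀ x ∈ N m, p n x = 0)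
    (ht : ⨆ n, N n = ⊤) : DirectSum.IsInternal N := by
  have h : ∀ (x : DirectSum ℕ fun n => N n) (n : ℕ),
      p n (DirectSum.coeAddMonoidHom N x) = x n := by
    intro x n
    induction x using DirectSum.induction_on with
    | zero => simp
    | add x y hx hy => simp only [map_add, hx, hy, DirectSum.add_apply, Submodule.coe_add]
    | of m x =>
      rw [DirectSum.coeAddMonoidHom_of]
      by_cases hmn : m = n
      · subst hmn
        rw [DirectSum.of_eq_same, hs m x x.2]
      · rw [DirectSum.of_eq_of_ne _ _ _ (Ne.symm hmn), hz m n hmn x x.2]; rfl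
  constructor
  · intro x y hxy
    refine DFinsupp.ext fun n => Subtype.ext ?_
    rw [← h x n, ← h y n, hxy]
  · intro x
    have hx : x ∈ ⨆ n, N n := ht ▸ Submodule.mem_top
    induction hx using Submodule.iSup_induction' with
    | mem n x hx => exact ⟨DirectSum.of (fun n => N n) n ⟨x, hx⟩, by simp⟩
    | zero => exact ⟨0, by simp⟩
    | add x y _ _ hx hy =>
      obtain ⟨x, rfl⟩ := hx
      obtain ⟨y, rfl⟩ := hy
      exact ⟨x + y, by simp⟩

end Internal

namespace FODC
namespace LeftCovariant
section Coinvariant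

variable {k H Γ : Type*} [Field k] [Ring H] [HopfAlgebra k H] [AddCommGroup Γ] [Module k Γ]
  [Module H Γ] [Module Hᵐᵒᵖ Γ] [SMulCommClass H Hᵐᵒᵖ Γ] [IsScalarTower k H Γ]
  [IsScalarTower k Hᵐᵒᵖ Γ] {F : FODC k H Γ} (C : F.LeftCovariant)

lemma proj_of_mem {n : ℕ} {x : F.MaxProlong} (hx : x ∈ F.grade n) (m : ℕ) :
    GradedAlgebra.proj F.grade m x = if n = m then x else 0 := by
  rw [GradedAlgebra.proj_apply]
  split_ifs with h
  · subst h; exact DirectSum.decompose_of_mem_same _ hx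
  · exact DirectSum.decompose_of_mem_ne _ hx h

/-- The elements of `H ⊗ Γ^∧` whose second factor has degree `n`. -/
def rightGrade (F : FODC k H Γ) (n : ℕ) : Submodule k (H ⊗[k] F.MaxProlong) :=
  Submodule.span k {t | ∃ (h : H) (ω : F.MaxProlong), ω ∈ F.grade n ∧ t = h ⊗ₜ ω}

lemma lTensor_mem_rightGrade {X : Type*} [AddCommGroup X] [Module k X] {n : ℕ}
    (f : X →ₗ[k] F.MaxProlong) (hf : ∀ x, f x ∈ F.grade n) (t : H ⊗[k] X) :
    f.lTensor H t ∈ rightGrade F n := by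
  induction t with
  | zero => simp
  | add x y hx hy => rw [map_add]; exact add_mem hx hy
  | tmul h x => exact Submodule.subset_span ⟨h, f x, hf x, rfl⟩

lemma rightGrade_mul {m n : ℕ} {s t : H ⊗[k] F.MaxProlong} (hs : s ∈ rightGrade F m)
    (ht : t ∈ rightGrade F n) : s * t ∈ rightGrade F (m + n) := by
  have h : rightGrade F m * rightGrade F n ≤ rightGrade F (m + n) := by
    rw [rightGrade, rightGrade, Submodule.span_mul_span, Submodule.span_le]
    rintro _ ⟨_, ⟨g, ω, hω, rfl⟩, _, ⟨h, η, hη, rfl⟩, rfl⟩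
    exact Submodule.subset_span ⟨g * h, ω * η, SetLike.mul_mem_graded hω hη, by simp⟩
  exact h (Submodule.mul_mem_mul hs ht)

lemma coaction_mem_rightGrade {n : ℕ} {x : F.MaxProlong} (hx : x ∈ F.grade n) :
    C.coaction x ∈ rightGrade F n := by
  induction n generalizing x with
  | zero =>
    obtain ⟨h, rfl⟩ : ∃ h, F.inH h = x := by simpa [grade] using hx
    rw [coaction_inH]
    exact lTensor_mem_rightGrade _ F.inH_mem_grade _
  | succ n ih =>
    rw [grade_succ] at hx
    induction hx using Submodule.mul_induction_on' with
    | mem_mul_mem u hu v hv =>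
      obtain ⟨γ, rfl⟩ := hv
      rw [map_mul, coaction_inΓ]
      exact rightGrade_mul (ih hu) (lTensor_mem_rightGrade _ F.inΓ_mem_grade _)
    | add u _ v _ hu hv => rw [map_add]; exact add_mem hu hv

lemma lTensor_proj {n : ℕ} {t : H ⊗[k] F.MaxProlong} (ht : t ∈ rightGrade F n) (m : ℕ) :
    (GradedAlgebra.proj F.grade m).lTensor H t = if n = m then t else 0 := by
  induction ht using Submodule.span_induction with
  | mem t ht =>
    obtain ⟨h, ω, hω, rfl⟩ := ht
    rw [LinearMap.lTensor_tmul, proj_of_mem hω]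
    split_ifs <;> simp
  | zero => simp
  | add x y _ _ hx hy => rw [map_add, hx, hy]; split_ifs <;> simp
  | smul r x _ hx => rw [map_smul, hx]; split_ifs <;> simp

/-- The coaction preserves degrees. -/
lemma coaction_proj (x : F.MaxProlong) (m : ℕ) : C.coaction (GradedAlgebra.proj F.grade m x) =
    (GradedAlgebra.proj F.grade m).lTensor H (C.coaction x) := by
  induction x using DirectSum.Decomposition.inductionOn F.grade with
  | zero => simp
  | homogeneous x =>
    rw [proj_of_mem x.2, lTensor_proj (C.coaction_mem_rightGrade x.2)]
    split_ifs <;> simp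
  | add x y hx hy => simp only [map_add, hx, hy]

/-- The projection of `Λ` on its component of degree `n`. -/
def projLam (n : ℕ) : C.Lam →ₗ[k] C.Lam :=
  (GradedAlgebra.proj F.grade n ∘ₗ C.Lam.val.toLinearMap).codRestrict
    (Subalgebra.toSubmodule C.Lam) fun θ => by
      have h : C.coaction θ = 1 ⊗ₜ (θ : F.MaxProlong) := θ.2
      change C.coaction (GradedAlgebra.proj F.grade n (θ : F.MaxProlong)) = _
      rw [coaction_proj, h]
      rfl

lemma coe_projLam (n : ℕ) (θ : C.Lam) :
    (C.projLam n θ : F.MaxProlong) = GradedAlgebra.proj F.grade n θ := rfl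

lemma projLam_mem (n : ℕ) (θ : C.Lam) : C.projLam n θ ∈ C.LamGrade n := by
  rw [mem_LamGrade, coe_projLam, GradedAlgebra.proj_apply]
  exact SetLike.coe_mem _

lemma projLam_of_mem {n : ℕ} {θ : C.Lam} (hθ : θ ∈ C.LamGrade n) (m : ℕ) :
    C.projLam m θ = if n = m then θ else 0 := by
  apply Subtype.ext
  rw [coe_projLam, proj_of_mem (C.mem_LamGrade.1 hθ)]
  split_ifs <;> rfl

lemma sum_projLam (θ : C.Lam) : ∃ s : Finset ℕ, θ = ∑ n ∈ s, C.projLam n θ := by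
  classical
  refine ⟨(DirectSum.decompose F.grade (θ : F.MaxProlong)).support, Subtype.ext ?_⟩
  rw [AddSubmonoidClass.coe_finsetSum]
  exact (DirectSum.sum_support_decompose F.grade (θ : F.MaxProlong)).symm

lemma conv_mem {R : Type*} [Ring R] [Algebra k R] (N : Submodule k R) (f g : H →ₗ[k] R)
    (hfg : ∀ a b, f a * g b ∈ N) (h : H) : conv f g h ∈ N := by
  rw [conv_apply]
  generalize Coalgebra.comul (R := k) h = s
  induction s with
  | zero => simp
  | add x y hx hy => rw [map_add, map_add]; exact add_mem hx hy
  | tmul a b => exact hfg a b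

lemma antip_mem (h : H) : antip F.inH h ∈ F.grade 0 := F.inH_mem_grade _

lemma hook_mem {n : ℕ} {θ : C.Lam} (hθ : θ ∈ C.LamGrade n) (h : H) :
    C.hook θ h ∈ C.LamGrade n := by
  rw [mem_LamGrade, coe_hook, hookFun_eq]
  refine conv_mem _ _ _ (fun a b => ?_) h
  have := SetLike.mul_mem_graded (antip_mem a)
    (SetLike.mul_mem_graded (C.mem_LamGrade.1 hθ) (F.inH_mem_grade b))
  rwa [add_zero, zero_add] at this

lemma maurerCartan_mem (h : H) : C.maurerCartan h ∈ C.LamGrade 1 := by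
  rw [mem_LamGrade, coe_maurerCartan]
  refine conv_mem _ _ _ (fun a b => ?_) h
  have := SetLike.mul_mem_graded (antip_mem a) (F.D_mem_grade (F.inH_mem_grade b))
  rwa [zero_add] at this

lemma LamGrade_mul {m n : ℕ} {θ η : C.Lam} (hθ : θ ∈ C.LamGrade m) (hη : η ∈ C.LamGrade n) :
    θ * η ∈ C.LamGrade (m + n) := by
  have h := SetLike.mul_mem_graded (C.mem_LamGrade.1 hθ) (C.mem_LamGrade.1 hη)
  exact h

end Coinvariant
end LeftCovariant
end FODC

namespace Ver
section Vertical

variable {k H A Γ : Type*} [Field k] [Ring H] [HopfAlgebra k H] [Ring A] [Algebra k A]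
  [AddCommGroup Γ] [Module k Γ] [Module H Γ] [Module Hᵐᵒᵖ Γ] [SMulCommClass H Hᵐᵒᵖ Γ]
  [IsScalarTower k H Γ] [IsScalarTower k Hᵐᵒᵖ Γ] {F : FODC k H Γ} (δ : ComoduleAlgebra k H A)
  (C : F.LeftCovariant)

lemma tmul_mem_grade {n : ℕ} (a : A) {θ : C.Lam} (hθ : θ ∈ C.LamGrade n) :
    of δ C (a ⊗ₜ θ) ∈ grade δ C n := ⟨a ⊗ₜ θ, ⟨a ⊗ₜ ⟨θ, hθ⟩, rfl⟩, rfl⟩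

lemma grade_induction {n : ℕ} {p : (x : Ver δ C) → x ∈ grade δ C n → Prop}
    (tmul : ∀ (a : A) (θ : C.Lam) (hθ : θ ∈ C.LamGrade n),
      p (of δ C (a ⊗ₜ θ)) (tmul_mem_grade δ C a hθ))
    (zero : p 0 (zero_mem _))
    (add : ∀ x hx y hy, p x hx → p y hy → p (x + y) (add_mem hx hy)) {x : Ver δ C}
    (hx : x ∈ grade δ C n) : p x hx := by
  suffices h : ∃ hx, p x hx from h.2
  obtain ⟨_, ⟨t, rfl⟩, rfl⟩ := hx
  induction t with
  | zero => exact ⟨by simp, by simpa using zero⟩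
  | add x y hx hy =>
    obtain ⟨hx, hx'⟩ := hx
    obtain ⟨hy, hy'⟩ := hy
    have := add _ _ _ _ hx' hy'
    simp only [map_add]
    exact ⟨add_mem hx hy, this⟩
  | tmul a θ => exact ⟨_, tmul a θ θ.2⟩

lemma mulLam_lTensor_mem {m n : ℕ} (f : H →ₗ[k] C.Lam) (hf : ∀ h, f h ∈ C.LamGrade m) {η : C.Lam}
    (hη : η ∈ C.LamGrade n) (g : A →ₗ[k] A) (t : A ⊗[k] H) :
    of δ C (mulLam C (TensorProduct.map g f t) η) ∈ grade δ C (m + n) := by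
  induction t with
  | zero => simp
  | add x y hx hy => simp only [map_add, LinearMap.add_apply]; exact add_mem hx hy
  | tmul a h =>
    rw [TensorProduct.map_tmul, mulLam_tmul]
    exact tmul_mem_grade δ C _ (C.LamGrade_mul (hf h) hη)

lemma emb_sgn {n : ℕ} {x : Ver δ C} (hx : x ∈ grade δ C n) :
    F.sgn.toLinearMap.lTensor A (emb δ C x) = (-1 : k) ^ n • emb δ C x := by
  induction hx using grade_induction with
  | zero => simp
  | add x _ y _ hx hy => simp only [map_add, hx, hy, smul_add]
  | tmul a θ hθ =>
    rw [emb_tmul, ComoduleAlgebra.pushHom_apply, ComoduleAlgebra.push_apply]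
    generalize δ.coact a = t
    induction t with
    | zero => simp
    | add x y hx hy => simp only [map_add, add_mul, smul_add, hx, hy]
    | tmul b h =>
      have h₁ : F.inH h * (θ : F.MaxProlong) ∈ F.grade n := by
        have := SetLike.mul_mem_graded (F.inH_mem_grade h) (C.mem_LamGrade.1 hθ)
        rwa [zero_add] at this
      have h₂ := F.sgn_of_mem h₁
      simp only [LinearMap.lTensor_tmul, AlgHom.toLinearMap_apply,
        Algebra.TensorProduct.tmul_mul_tmul, mul_one, h₂, TensorProduct.tmul_smul]

lemma D_D (x : Ver δ C) : D δ C (D δ C x) = 0 := by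
  have h : ∀ t : A ⊗[k] F.MaxProlong, F.D.lTensor A (F.D.lTensor A t) = 0 := by
    intro t
    induction t with
    | zero => simp
    | add x y hx hy => simp only [map_add, hx, hy, add_zero]
    | tmul a x => simp only [LinearMap.lTensor_tmul, F.D_D, TensorProduct.tmul_zero]
  apply emb_injective δ C
  rw [emb_D, emb_D, h, map_zero]

lemma D_mul {n : ℕ} {x : Ver δ C} (hx : x ∈ grade δ C n) (y : Ver δ C) :
    D δ C (x * y) = D δ C x * y + (-1 : k) ^ n • (x * D δ C y) := by
  apply emb_injective δ C
  rw [emb_D, emb_mul, F.map_D_mul, emb_sgn δ C hx, smul_mul_assoc, map_add, map_smul, emb_mul,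
    emb_mul, emb_D, emb_D]

/-- The vertical forms are a differential graded algebra. -/
theorem isDGA : IsDGA (grade δ C) (D δ C) where
  graded :=
    { one_mem := tmul_mem_grade δ C 1 (C.mem_LamGrade.2 SetLike.GradedOne.one_mem)
      mul_mem := by
        intro m n x y hx hy
        induction hx using grade_induction with
        | zero => simp
        | add x _ y _ hx hy => rw [add_mul]; exact add_mem hx hy
        | tmul a θ hθ =>
          induction hy using grade_induction with
          | zero => simp
          | add x _ y _ hx hy => rw [mul_add]; exact add_mem hx hy
          | tmul b η hη =>
            rw [mul_def, vmul_tmul, TensorProduct.map₂_apply_tmul]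
            exact mulLam_lTensor_mem δ C _ (C.hook_mem hθ) hη _ _ }
  internal := by
    refine isInternal_of_proj _ (fun n => (of δ C).toLinearMap ∘ₗ (C.projLam n).lTensor A ∘ₗ
      (of δ C).symm.toLinearMap) ?_ ?_ ?_
    · intro n x hx
      induction hx using grade_induction with
      | zero => simp
      | add x _ y _ hx hy => rw [map_add, hx, hy]
      | tmul a θ hθ =>
        change of δ C (a ⊗ₜ C.projLam n θ) = _
        rw [C.projLam_of_mem hθ, if_pos rfl]
    · intro m n hmn x hx
      induction hx using grade_induction with
      | zero => simp
      | add x _ y _ hx hy => rw [map_add, hx, hy, add_zero]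
      | tmul a θ hθ =>
        change of δ C (a ⊗ₜ C.projLam n θ) = _
        rw [C.projLam_of_mem hθ, if_neg hmn, TensorProduct.tmul_zero, map_zero]
    · rw [eq_top_iff]
      intro x _
      obtain ⟨x, rfl⟩ := (of δ C).surjective x
      induction x with
      | zero => simp
      | add x y hx hy => rw [map_add]; exact add_mem (hx trivial) (hy trivial)
      | tmul a θ =>
        obtain ⟨s, hs⟩ := C.sum_projLam θ
        rw [hs, TensorProduct.tmul_sum, map_sum]
        exact sum_mem fun n _ => Submodule.mem_iSup_of_mem n
          (tmul_mem_grade δ C a (C.projLam_mem n θ))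
  d_mem := by
    intro n x hx
    induction hx using grade_induction with
    | zero => simp
    | add x _ y _ hx hy => rw [map_add]; exact add_mem hx hy
    | tmul a θ hθ =>
      rw [D_tmul]
      refine add_mem (tmul_mem_grade δ C a (C.mem_LamGrade.2 (F.D_mem_grade hθ))) ?_
      rw [add_comm n 1]
      exact mulLam_lTensor_mem δ C (C.maurerCartan ∘ₗ FODC.LeftCovariant.piEps k H)
        (fun h => C.maurerCartan_mem (FODC.LeftCovariant.piEps k H h)) hθ LinearMap.id (δ.coact a)
  d_d := D_D δ C
  leibniz n x hx y := D_mul δ C hx y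

end Vertical
end Ver

/-! ### Complete differential calculi -/

section Complete

variable {k H A Γ Ω : Type*} [Field k] [Ring H] [HopfAlgebra k H] [Ring A] [Algebra k A]
  [AddCommGroup Γ] [Module k Γ] [Module H Γ] [Module Hᵐᵒᵖ Γ] [SMulCommClass H Hᵐᵒᵖ Γ]
  [IsScalarTower k H Γ] [IsScalarTower k Hᵐᵒᵖ Γ] [Ring Ω] [Algebra k Ω]

/-- The algebra morphism `Δ : Ω(A) → Ω(A) ⊗ Ω(H)` is a morphism of differential graded algebras to
the graded tensor product with `Ω(H) = Γ^∧`, and it extends the coaction of `A`. A differential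
calculus on `A` is complete if there is such a morphism. -/
structure IsCoactionExtension (δ : ComoduleAlgebra k H A) (F : FODC k H Γ) (incl : A →ₐ[k] Ω)
    (𝒜 : ℕ → Submodule k Ω) [GradedAlgebra 𝒜] (d : Ω →ₗ[k] Ω)
    (Δ : Ω →ₐ[k] 𝒜 ᵍ⊗[k] F.grade) : Prop where
  isDGAHom : IsDGAHom 𝒜 d (tensorGrade 𝒜 F.grade) (tensorD 𝒜 d F.grade F.D) Δ
  extends_coact : ∀ a, Δ (incl a) = GradedTensorProduct.of k 𝒜 F.grade
    (TensorProduct.map incl.toLinearMap F.inH.toLinearMap (δ.coact a))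

/-- The map `a ↦ a₀ ⊗ a₁ ⊗ f(a₂)`. -/
def ComoduleAlgebra.push₂ (δ : ComoduleAlgebra k H A) (f : H →ₗ[k] Ω) :
    A →ₗ[k] A ⊗[k] (H ⊗[k] Ω) :=
  (f.lTensor H ∘ₗ Coalgebra.comul).lTensor A ∘ₗ δ.coact.toLinearMap

/-- The element `a⁰₀ a¹₀ … aⁿ₀ ⊗ S(a⁰₁ a¹₁ … aⁿ₁) a⁰₂ da¹₂ ∧ … ∧ daⁿ₂` of `A ⊗ Γ^∧`: the product
of `a⁰₀ ⊗ a⁰₁ ⊗ a⁰₂` and the `aⁱ₀ ⊗ aⁱ₁ ⊗ daⁱ₂` in `A ⊗ H ⊗ Γ^∧`, followed by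
`x ⊗ h ⊗ ω ↦ x ⊗ S(h) ω`. -/
def verticalForm (δ : ComoduleAlgebra k H A) (F : FODC k H Γ) {n : ℕ} (a : Fin (n + 1) → A) :
    A ⊗[k] F.MaxProlong :=
  (FODC.LeftCovariant.antipMul F).lTensor A
    (δ.push₂ F.inH.toLinearMap (a 0) *
      (List.ofFn fun i : Fin n => δ.push₂ (F.D ∘ₗ F.inH.toLinearMap) (a i.succ)).prod)

end Complete

end NCBundle

end

noncomputable section

namespace NCBundle

/-! ### The degree zero projection of a differential calculus -/

section DegreeZero

variable {k Ω Ω' A : Type*} [Field k] [Ring Ω] [Algebra k Ω] [Ring Ω'] [Algebra k Ω']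
  [Ring A] [Algebra k A] {incl : A →ₐ[k] Ω} {𝒜 : ℕ → Submodule k Ω} [GradedAlgebra 𝒜]
  {d : Ω →ₗ[k] Ω}

/-! Everything takes place inside `A ⊗ Γ^∧`, with the ordinary tensor product algebra and the map
`id ⊗ d`. Two algebra morphisms lead into it, both compatible with the differentials and both given
on `A` by `a ↦ a₀ ⊗ a₁`.

The first is `emb : a ⊗ θ ↦ a₀ ⊗ a₁θ`, from the vertical forms. It is injective because `a ⊗ ω ↦ a₀
⊗ S(a₁)ω` undoes it. The second is `Φ = (p ⊗ id) ∘ Δ`, from `Ω(A)`, where `p : Ω(A) → A` is the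
projection on degree zero. As `p` vanishes in positive degrees, the signs of the graded tensor
product disappear and `Φ` is multiplicative; as `p ∘ d = 0`, only `id ⊗ d` survives from the
differential of the tensor product (`degreeZeroTensor_tensorD`). Hence `Φ` and `emb` take the same
values on the forms `a⁰ da¹ ∧ … ∧ daⁿ` of `Ω(A)` and of the vertical forms. These span `Ω(A)`, so
`Φ` has image in the range of `emb`, and `π = emb⁻¹ ∘ Φ` is the required morphism. Uniqueness holds
because a morphism that respects `d` is determined on these forms by its values on `A`.

Surjectivity is where the Hopf-Galois condition enters. The range of `π` is a subalgebra `R` that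
contains `A` and `dA`. Surjectivity of the canonical map says that the elements `a b₀ ⊗ b₁` span `A
⊗ H`; so if `b₀ ⊗ f(b₁)` lies in `R` for all `b`, multiplication by `A` from the left gives `1 ⊗
f(h) ∈ R` for all `h`. From `db = b₀ ⊗ ϖ(b₁)` and `(1 ⊗ θ) b = b₀ ⊗ (θ ↼ b₁)` it follows that the
`θ` with `1 ⊗ θ ∈ R` form a subalgebra `T` of `Λ` that contains all `ϖ(h)` and is stable under `↼`.
Then `H T` is a right ideal of `Γ^∧`, by `θ h = h₁ (θ ↼ h₂)` and `dh = h₁ ϖ(h₂)`; it contains `1`,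
so it is everything, and `π_inv(hθ) = ε(h)θ` gives `T = Λ` (`eq_top_of_maurerCartan_mem`,
`eq_top_of_inA_mem`).

The formulas follow from `(id ⊗ π_inv) ∘ emb = id`, which gives `π = (id ⊗ π_inv) ∘ Φ`. In total
degree `n`, left degree zero is the same as right degree `n`, so `p ⊗ id` may be replaced by the
projection on `Ωⁿ(H)`. The explicit expression results from the left coaction on `Γ^∧` being
multiplicative and commuting with `d`. -/

/-- A calculus on `A` has an algebra morphism to `A` that is the projection on degree zero. -/
lemma IsDifferentialCalculus.exists_degreeZero (hΩ : IsDifferentialCalculus incl 𝒜 d) :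
    ∃ p : Ω →ₐ[k] A, ∀ x, incl (p x) = GradedAlgebra.proj 𝒜 0 x := by
  have h : ∀ x, ∃ a, incl a = GradedAlgebra.proj 𝒜 0 x := fun x => by
    have hx : GradedAlgebra.proj 𝒜 0 x ∈ 𝒜 0 := by
      rw [GradedAlgebra.proj_apply]; exact SetLike.coe_mem _
    rw [← hΩ.range_incl] at hx
    exact hx
  choose p hp using h
  -- Since `incl` is injective, identities for `p` can be checked for the projection on degree zero.
  -- That projection is multiplicative because degrees are natural numbers: only factors of degree
  -- zero contribute to the degree zero part of a product.
  refine ⟨AlgHom.ofLinearMap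
    { toFun := p
      map_add' := fun x y => hΩ.incl_injective (by simp only [map_add, hp])
      map_smul' := fun r x => hΩ.incl_injective (by simp only [map_smul, hp, RingHom.id_apply]) }
    (hΩ.incl_injective ?_) (fun x y => hΩ.incl_injective ?_), hp⟩
  · change incl (p 1) = _
    rw [hp, map_one incl]
    exact map_one (GradedRing.projZeroRingHom 𝒜)
  · change incl (p (x * y)) = incl (p x * p y)
    rw [map_mul, hp, hp, hp]
    exact map_mul (GradedRing.projZeroRingHom 𝒜) x y

lemma proj_of_mem_graded {n : ℕ} {x : Ω} (hx : x ∈ 𝒜 n) (m : ℕ) :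
    GradedAlgebra.proj 𝒜 m x = if n = m then x else 0 := by
  rw [GradedAlgebra.proj_apply]
  split_ifs with h
  · subst h; exact DirectSum.decompose_of_mem_same _ hx
  · exact DirectSum.decompose_of_mem_ne _ hx h

lemma gradeInvol_of_mem {n : ℕ} {x : Ω} (hx : x ∈ 𝒜 n) : gradeInvol 𝒜 x = (-1 : k) ^ n • x := by
  rw [gradeInvol, LinearMap.comp_apply, LinearEquiv.coe_coe, DirectSum.decomposeLinearEquiv_apply,
    DirectSum.decompose_of_mem _ hx, ← DirectSum.lof_eq_of k, DirectSum.toModule_lof]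
  rfl

lemma degreeZero_of_mem_ne {p : Ω →ₐ[k] A} (hp : ∀ x, incl (p x) = GradedAlgebra.proj 𝒜 0 x)
    (hi : Function.Injective incl) {n : ℕ} (hn : n ≠ 0) {x : Ω} (hx : x ∈ 𝒜 n) : p x = 0 := by
  apply hi
  rw [hp, proj_of_mem_graded hx, if_neg hn, map_zero]

variable {ℬ : ℕ → Submodule k Ω'} [GradedAlgebra ℬ] {p : Ω →ₐ[k] A}

/-- The algebra morphism `x ⊗ y ↦ p(x) ⊗ y` from a graded tensor product to an ungraded one, for an
algebra morphism `p` that vanishes in positive degrees. -/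
def degreeZeroTensor (ℬ : ℕ → Submodule k Ω') [GradedAlgebra ℬ]
    (hp : ∀ n, n ≠ 0 → ∀ x ∈ 𝒜 n, p x = 0) : 𝒜 ᵍ⊗[k] ℬ →ₐ[k] A ⊗[k] Ω' :=
  GradedTensorProduct.lift 𝒜 ℬ (Algebra.TensorProduct.includeLeft.comp p)
    Algebra.TensorProduct.includeRight (fun i j a b => by
      -- The lift requires the two images to commute up to `(-1)^(ij)`. For `i = 0` the sign is
      -- trivial and the two tensor factors commute; for `i ≠ 0` both sides vanish.
      by_cases hi : i = 0
      · subst hi; simp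
      · simp [hp i hi a a.2])

lemma degreeZeroTensor_apply (hp : ∀ n, n ≠ 0 → ∀ x ∈ 𝒜 n, p x = 0) (t : 𝒜 ᵍ⊗[k] ℬ) :
    degreeZeroTensor ℬ hp t =
      p.toLinearMap.rTensor Ω' ((GradedTensorProduct.of k 𝒜 ℬ).symm t) := by
  obtain ⟨t, rfl⟩ := (GradedTensorProduct.of k 𝒜 ℬ).surjective t
  induction t with
  | zero => simp
  | add x y hx hy => simp only [map_add, hx, hy]
  | tmul x y => exact (GradedTensorProduct.lift_tmul 𝒜 ℬ _ _ _ x y).trans (by simp)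

lemma apply_d_eq_zero (hp : ∀ n, n ≠ 0 → ∀ x ∈ 𝒜 n, p x = 0)
    (hd : ∀ n, ∀ x ∈ 𝒜 n, d x ∈ 𝒜 (n + 1)) (x : Ω) : p (d x) = 0 := by
  induction x using DirectSum.Decomposition.inductionOn 𝒜 with
  | zero => simp
  | homogeneous x => exact hp _ (Nat.succ_ne_zero _) _ (hd _ x x.2)
  | add x y hx hy => rw [map_add, map_add, hx, hy, add_zero]

lemma apply_gradeInvol (hp : ∀ n, n ≠ 0 → ∀ x ∈ 𝒜 n, p x = 0) (x : Ω) :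
    p (gradeInvol 𝒜 x) = p x := by
  induction x using DirectSum.Decomposition.inductionOn 𝒜 with
  | zero => simp
  | @homogeneous n x =>
    rw [gradeInvol_of_mem x.2, map_smul]
    by_cases hn : n = 0
    · subst hn; simp
    · rw [hp n hn x x.2, smul_zero]
  | add x y hx hy => rw [map_add, map_add, map_add, hx, hy]

/-- Of the two summands of the differential, `dx ⊗ y` dies because `dx` has no degree zero part, and
the sign in `(-1)^{|x|} x ⊗ d'y` is invisible to `p`, which sees only `|x| = 0`. -/
lemma degreeZeroTensor_tensorD (hp : ∀ n, n ≠ 0 → ∀ x ∈ 𝒜 n, p x = 0)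
    (hd : ∀ n, ∀ x ∈ 𝒜 n, d x ∈ 𝒜 (n + 1)) (d' : Ω' →ₗ[k] Ω') (t : 𝒜 ᵍ⊗[k] ℬ) :
    degreeZeroTensor ℬ hp (tensorD 𝒜 d ℬ d' t) = d'.lTensor A (degreeZeroTensor ℬ hp t) := by
  rw [degreeZeroTensor_apply, degreeZeroTensor_apply]
  obtain ⟨t, rfl⟩ := (GradedTensorProduct.of k 𝒜 ℬ).surjective t
  induction t with
  | zero => simp
  | add x y hx hy => simp only [map_add, hx, hy]
  | tmul x y => simp [tensorD, apply_d_eq_zero hp hd, apply_gradeInvol hp]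

/-- In total degree `n`, the component of right degree `n` is that of left degree zero. -/
lemma lTensor_proj_of_mem_tensorGrade {n : ℕ} {t : 𝒜 ᵍ⊗[k] ℬ} (ht : t ∈ tensorGrade 𝒜 ℬ n) :
    (GradedAlgebra.proj ℬ n).lTensor Ω ((GradedTensorProduct.of k 𝒜 ℬ).symm t) =
      (GradedAlgebra.proj 𝒜 0).rTensor Ω' ((GradedTensorProduct.of k 𝒜 ℬ).symm t) := by
  have h : tensorGrade 𝒜 ℬ n ≤ LinearMap.eqLocus
      ((GradedAlgebra.proj ℬ n).lTensor Ω ∘ₗ (GradedTensorProduct.of k 𝒜 ℬ).symm.toLinearMap)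
      ((GradedAlgebra.proj 𝒜 0).rTensor Ω' ∘ₗ
        (GradedTensorProduct.of k 𝒜 ℬ).symm.toLinearMap) := by
    refine iSup₂_le fun q hq => ?_
    rintro _ ⟨_, ⟨s, rfl⟩, rfl⟩
    rw [Finset.HasAntidiagonal.mem_antidiagonal] at hq
    induction s with
    | zero => simp
    | add x y hx hy => rw [map_add, map_add]; exact add_mem hx hy
    | tmul x y =>
      simp only [LinearMap.mem_eqLocus, LinearMap.coe_comp, LinearEquiv.coe_coe,
        Function.comp_apply, TensorProduct.map_tmul, Submodule.subtype_apply,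
        GradedTensorProduct.of_symm_of, LinearMap.lTensor_tmul, LinearMap.rTensor_tmul,
        proj_of_mem_graded x.2, proj_of_mem_graded y.2]
      -- Since `q.1 + q.2 = n`, the conditions `q.1 = 0` and `q.2 = n` are equivalent: both
      -- projections fix `x ⊗ y` or both kill it.
      by_cases h0 : q.1 = 0
      · rw [if_pos h0, if_pos (by omega)]
      · rw [if_neg h0, if_neg (by omega), TensorProduct.zero_tmul, TensorProduct.tmul_zero]
  exact h ht

end DegreeZero

/-! ### Morphisms out of a calculus are determined by their values on forms -/

section DGAHom

variable {k Ω Ω' A : Type*} [Field k] [Ring Ω] [Algebra k Ω] [Ring Ω'] [Algebra k Ω']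
  [Ring A] [Algebra k A] {incl : A →ₐ[k] Ω} {incl' : A →ₐ[k] Ω'} {𝒜 : ℕ → Submodule k Ω}
  {d : Ω →ₗ[k] Ω} {d' : Ω' →ₗ[k] Ω'}

/-- Compatibility with the differentials is needed on `A` only, and nothing is assumed about `d'`.
The lemma therefore applies to `A ⊗ Γ^∧` with `id ⊗ d` without a grading there. -/
lemma map_form {f : Ω →ₐ[k] Ω'} (hf : ∀ a, f (incl a) = incl' a)
    (hd : ∀ a, f (d (incl a)) = d' (incl' a)) {n : ℕ} (a : Fin (n + 1) → A) :
    f (form incl d a) = form incl' d' a := by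
  rw [form, form, map_mul, map_list_prod, List.map_ofFn, hf]
  simp only [Function.comp_def, hd]

lemma form_mem {ℬ : ℕ → Submodule k Ω'} [SetLike.GradedMonoid ℬ] (h0 : ∀ a, incl' a ∈ ℬ 0)
    (hd : ∀ n, ∀ x ∈ ℬ n, d' x ∈ ℬ (n + 1)) {n : ℕ} (a : Fin (n + 1) → A) :
    form incl' d' a ∈ ℬ n := by
  -- The induction runs over the product of differentials alone, with free entries, since removing
  -- its first factor shifts the remaining ones.
  have h : ∀ (n : ℕ) (b : Fin n → A), (List.ofFn fun i => d' (incl' (b i))).prod ∈ ℬ n := by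
    intro n b
    induction n with
    | zero => simpa using SetLike.GradedOne.one_mem
    | succ n ih =>
      have := SetLike.mul_mem_graded (hd 0 _ (h0 (b 0))) (ih fun i => b i.succ)
      rw [zero_add, add_comm] at this
      rwa [List.ofFn_succ, List.prod_cons]
  have := SetLike.mul_mem_graded (h0 (a 0)) (h n fun i => a i.succ)
  rwa [zero_add] at this

/-- A calculus is spanned by the forms `a⁰ da¹ ∧ … ∧ daⁿ`. -/
lemma IsDifferentialCalculus.le_of_form_mem (hΩ : IsDifferentialCalculus incl 𝒜 d)
    {N : Submodule k Ω} (h : ∀ (n : ℕ) (a : Fin (n + 1) → A), form incl d a ∈ N) (x : Ω) :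
    x ∈ N := by
  have hx : x ∈ ⨆ n, 𝒜 n := hΩ.internal.submodule_iSup_eq_top ▸ Submodule.mem_top
  refine (iSup_le fun n => ?_ : ⨆ n, 𝒜 n ≤ N) hx
  rw [hΩ.generated, Submodule.span_le]
  rintro _ ⟨a, rfl⟩
  exact h n a

/-- Both morphisms send `a⁰ da¹ ∧ … ∧ daⁿ` to the same expression in `d'` and the common images of
the `aⁱ`, and such forms span. -/
lemma IsDifferentialCalculus.algHom_ext (hΩ : IsDifferentialCalculus incl 𝒜 d) {f g : Ω →ₐ[k] Ω'}
    (hf : ∀ x, f (d x) = d' (f x)) (hg : ∀ x, g (d x) = d' (g x))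
    (hfg : ∀ a, f (incl a) = g (incl a)) : f = g := by
  refine AlgHom.ext fun x => hΩ.le_of_form_mem (N := LinearMap.eqLocus f.toLinearMap g.toLinearMap)
    (fun n a => ?_) x
  change f _ = g _
  rw [map_form (incl' := g.comp incl) (d' := d') hfg (fun a => by rw [hf, hfg]; rfl),
    map_form (incl' := g.comp incl) (d' := d') (fun _ => rfl) (fun a => hg _)]

end DGAHom

/-! ### Generation of the vertical forms -/

section Generation

variable {k H A Γ : Type*} [Field k] [Ring H] [HopfAlgebra k H] [Ring A] [Algebra k A]
  [AddCommGroup Γ] [Module k Γ] [Module H Γ] [Module Hᵐᵒᵖ Γ] [SMulCommClass H Hᵐᵒᵖ Γ]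
  [IsScalarTower k H Γ] [IsScalarTower k Hᵐᵒᵖ Γ] {F : FODC k H Γ} (δ : ComoduleAlgebra k H A)
  (C : F.LeftCovariant)

/-- `π_inv(h θ) = ε(h) θ` for a left coinvariant form `θ`. -/
lemma FODC.LeftCovariant.piInv_inH_mul (h : H) (θ : C.Lam) :
    C.piInv (F.inH h * θ) = Coalgebra.counit (R := k) h • θ := by
  have h₁ : antipMul F (F.inH.toLinearMap.lTensor H (Coalgebra.comul h)) =
      conv (antip F.inH) F.inH.toLinearMap h := by
    rw [conv_apply]
    generalize Coalgebra.comul (R := k) h = s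
    induction s with
    | zero => simp
    | add x y hx hy => simp only [map_add, hx, hy]
    | tmul a b => simp [antip_apply]
  apply Subtype.ext
  -- The coaction of `hθ` is `(h₁ ⊗ h₂)(1 ⊗ θ)`, so `θ` comes out on the right and leaves `S(h₁)h₂ =
  -- ε(h)`.
  rw [coe_piInv, map_mul, C.mem_Lam.1 θ.2, antipMul_mul, coaction_inH, h₁, antip_conv]
  simp [convUnit, Algebra.algebraMap_eq_smul_one]

lemma FODC.LeftCovariant.piInv_coe (θ : C.Lam) : C.piInv θ = θ := by
  simpa using C.piInv_inH_mul 1 θ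

/-- A subalgebra of `Λ` that is stable under the right action of `H` and contains the Maurer-Cartan
forms is all of `Λ`. -/
lemma FODC.LeftCovariant.eq_top_of_maurerCartan_mem (T : Subalgebra k C.Lam)
    (hook : ∀ θ ∈ T, ∀ h, C.hook θ h ∈ T) (mc : ∀ h, C.maurerCartan h ∈ T) : T = ⊤ := by
  -- `N = H T` will be shown to be a right ideal of `Γ^∧` that contains `1`.
  let N : Submodule k F.MaxProlong := LinearMap.range F.inH.toLinearMap *
    (Subalgebra.toSubmodule T).map C.Lam.val.toLinearMap
  have hN : ∀ h, ∀ θ ∈ T, F.inH h * (θ : F.MaxProlong) ∈ N := fun h θ hθ =>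
    Submodule.mul_mem_mul ⟨h, rfl⟩ ⟨θ, hθ, rfl⟩
  have ind : ∀ z : F.MaxProlong, (∀ h, ∀ θ ∈ T, F.inH h * (θ : F.MaxProlong) * z ∈ N) →
      ∀ y ∈ N, y * z ∈ N := by
    intro z hz y hy
    induction hy using Submodule.mul_induction_on' with
    | mem_mul_mem u hu v hv =>
      obtain ⟨h, rfl⟩ := hu
      obtain ⟨θ, hθ, rfl⟩ := hv
      exact hz h θ hθ
    | add u _ v _ hu hv => rw [add_mul]; exact add_mem hu hv
  have mulH : ∀ h, ∀ y ∈ N, y * F.inH h ∈ N := by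
    intro h
    refine ind _ fun g θ hθ => ?_
    -- The relation `θ h = h₁ (θ ↼ h₂)` moves `h` to the left of `θ`, and the stability of `T` keeps
    -- the right factor in `T`.
    have h₁ := DFunLike.congr_fun (conv_hookFun (F := F) (θ : F.MaxProlong)) h
    rw [LinearMap.comp_apply, LinearMap.mulLeft_apply, AlgHom.toLinearMap_apply] at h₁
    rw [mul_assoc, ← h₁, conv_apply]
    generalize Coalgebra.comul (R := k) h = s
    induction s with
    | zero => simp
    | add x y hx hy => simp only [map_add, mul_add]; exact add_mem hx hy
    | tmul a b =>
      have := hN (g * a) _ (hook θ hθ b)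
      rw [coe_hook, map_mul, mul_assoc] at this
      exact this
  have mulT : ∀ η ∈ T, ∀ y ∈ N, y * (η : F.MaxProlong) ∈ N := by
    intro η hη
    refine ind _ fun g θ hθ => ?_
    rw [mul_assoc]
    exact hN g _ (T.mul_mem hθ hη)
  have mulD : ∀ h, ∀ y ∈ N, y * F.D (F.inH h) ∈ N := by
    intro h y hy
    -- As `dh = h₁ ϖ(h₂)`, multiplication by `dh` is a sum of multiplications by elements of `H`
    -- followed by elements of `T`.
    have h₁ := DFunLike.congr_fun C.conv_maurerCartan h
    rw [LinearMap.comp_apply, AlgHom.toLinearMap_apply] at h₁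
    rw [← h₁, conv_apply]
    generalize Coalgebra.comul (R := k) h = s
    induction s with
    | zero => simp
    | add x y hx hy => simp only [map_add, mul_add]; exact add_mem hx hy
    | tmul a b =>
      have := mulT _ (mc b) _ (mulH a y hy)
      rw [mul_assoc] at this
      exact this
  have mulAll : ∀ x, ∀ y ∈ N, y * x ∈ N := by
    intro x
    induction x using F.induction with
    | inH h => exact mulH h
    | inΓ γ =>
      obtain ⟨t, rfl⟩ := F.adb_surjective γ
      intro y hy
      induction t with
      | zero => simp
      | add u v hu hv => rw [map_add, map_add, mul_add]; exact add_mem hu hv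
      | tmul a b =>
        rw [FODC.adb_tmul, FODC.inΓ_smul, ← FODC.D_inH, ← mul_assoc]
        exact mulD b _ (mulH a y hy)
    | mul x x' hx hx' => intro y hy; rw [← mul_assoc]; exact hx' _ (hx _ hy)
    | add x x' hx hx' => intro y hy; rw [mul_add]; exact add_mem (hx _ hy) (hx' _ hy)
  -- `π_inv` brings `N` back to `T` because `π_inv(hθ) = ε(h)θ`; since `π_inv` fixes `Λ`, it then
  -- remains to see that `N` is everything.
  have hpi : ∀ x ∈ N, C.piInv x ∈ T := by
    intro x hx
    induction hx using Submodule.mul_induction_on' with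
    | mem_mul_mem u hu v hv =>
      obtain ⟨h, rfl⟩ := hu
      obtain ⟨θ, hθ, rfl⟩ := hv
      have := T.smul_mem hθ (Coalgebra.counit (R := k) h)
      rw [← C.piInv_inH_mul] at this
      exact this
    | add u _ v _ hu hv => rw [map_add]; exact add_mem hu hv
  refine eq_top_iff.2 fun θ _ => ?_
  rw [← C.piInv_coe θ]
  refine hpi _ ?_
  have h₁ : (1 : F.MaxProlong) ∈ N := by simpa using hN 1 1 T.one_mem
  simpa using mulAll (θ : F.MaxProlong) 1 h₁

/-- If the canonical map is surjective, then a linear map on `A ⊗ H` is determined up to a subspace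
by its values on the elements `a b₀ ⊗ b₁`. -/
lemma ComoduleAlgebra.map_mem_of_canonicalMap_surjective
    (hs : Function.Surjective δ.canonicalMap) {V : Type*} [AddCommGroup V] [Module k V]
    (φ : A ⊗[k] H →ₗ[k] V) (N : Submodule k V)
    (hφ : ∀ a b, φ ((a ⊗ₜ 1) * δ.coact b) ∈ N) (t : A ⊗[k] H) : φ t ∈ N := by
  obtain ⟨q, rfl⟩ := hs t
  obtain ⟨s, rfl⟩ := QuotientAddGroup.mk_surjective q
  induction s with
  | zero => simp
  | add x y hx hy => rw [QuotientAddGroup.mk_add, map_add, map_add]; exact add_mem hx hy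
  | tmul a b => exact hφ a b

/-! ### Vertical forms: generation by `A` and `dA`, and recovery from `A ⊗ Γ^∧` -/

namespace Ver

/-- The map `a ⊗ θ ↦ a₀ ⊗ a₁ θ` as an algebra morphism. -/
def embHom : Ver δ C →ₐ[k] A ⊗[k] F.MaxProlong :=
  AlgHom.ofLinearMap (emb δ C) (emb_one δ C) (emb_mul δ C)

@[simp] lemma embHom_apply (x : Ver δ C) : embHom δ C x = emb δ C x := rfl

/-- The value `a₀ ⊗ a₁` is also that of `(p ⊗ id) ∘ Δ` on `A`; this agreement makes the two
morphisms into `A ⊗ Γ^∧` comparable. -/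
lemma emb_inA (a : A) : emb δ C (inA δ C a) = δ.pushHom F.inH a := by
  rw [inA_apply, emb_tmul]
  exact mul_one _

lemma inA_mul_tmul (a b : A) (θ : C.Lam) :
    inA δ C a * of δ C (b ⊗ₜ θ) = of δ C ((a * b) ⊗ₜ θ) :=
  emb_injective δ C (by rw [emb_mul, emb_inA, emb_tmul, emb_tmul, map_mul, mul_assoc])

lemma tmul_mul_one_tmul (a : A) (θ η : C.Lam) :
    of δ C (a ⊗ₜ θ) * of δ C (1 ⊗ₜ η) = of δ C (a ⊗ₜ (θ * η)) :=
  emb_injective δ C (by simp [emb_mul, emb_tmul, mul_assoc])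

/-- This puts `b₀ ⊗ (θ ↼ b₁)` in every subalgebra that contains `A` and `1 ⊗ θ`, from which
stability under `↼` will be extracted. -/
lemma one_tmul_mul_inA (θ : C.Lam) (b : A) :
    of δ C (1 ⊗ₜ θ) * inA δ C b = of δ C ((C.hook θ).lTensor A (δ.coact b)) := by
  rw [inA_apply, mul_def, vmul_tmul]
  generalize δ.coact b = t
  induction t with
  | zero => simp
  | add x y hx hy => simp only [map_add, LinearMap.add_apply, hx, hy]
  | tmul a h => simp

/-- The term with `d1` vanishes and `ϖ ∘ π_ε = ϖ`. What remains, `b₀ ⊗ ϖ(b₁)`, is the source of the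
Maurer-Cartan forms in a subalgebra that contains `dA`. -/
lemma D_inA (b : A) : D δ C (inA δ C b) = of δ C (C.maurerCartan.lTensor A (δ.coact b)) := by
  have h₁ : C.maurerCartan ∘ₗ FODC.LeftCovariant.piEps k H = C.maurerCartan :=
    LinearMap.ext C.maurerCartan_piEps
  have h₂ : C.dLam 1 = 0 := Subtype.ext (by
    rw [FODC.LeftCovariant.coe_dLam, OneMemClass.coe_one, ← map_one F.inH, FODC.D_inH, FODC.d_one,
      map_zero, ZeroMemClass.coe_zero])
  rw [inA_apply, D_tmul, h₁, h₂, TensorProduct.tmul_zero, map_zero, zero_add]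
  generalize δ.coact b = t
  induction t with
  | zero => simp
  | add x y hx hy => simp only [map_add, LinearMap.add_apply, hx, hy]
  | tmul a h => simp

/-- For `t = b₀ ⊗ b₁` the argument on the right is the image of `a ⊗ b` under the canonical map, so
the Hopf-Galois condition can be applied to products of elements of `A` with `b₀ ⊗ f(b₁)`. -/
lemma inA_mul_lTensor (f : H →ₗ[k] C.Lam) (a : A) (t : A ⊗[k] H) :
    inA δ C a * of δ C (f.lTensor A t) = of δ C (f.lTensor A ((a ⊗ₜ 1) * t)) := by
  induction t with
  | zero => simp
  | add x y hx hy => simp only [map_add, mul_add, hx, hy]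
  | tmul b h => simp [inA_mul_tmul]

/-- If the canonical map is surjective, the vertical forms are generated by `A` and `dA`. -/
lemma eq_top_of_inA_mem (hs : Function.Surjective δ.canonicalMap) (R : Subalgebra k (Ver δ C))
    (hA : ∀ a, inA δ C a ∈ R) (hD : ∀ a, D δ C (inA δ C a) ∈ R) : R = ⊤ := by
  -- `T` collects the `θ` with `1 ⊗ θ` in `R`. It is closed under products because `(1 ⊗ θ)(1 ⊗ η) =
  -- 1 ⊗ θη`.
  let T : Subalgebra k C.Lam :=
    { carrier := {θ | of δ C (1 ⊗ₜ θ) ∈ R}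
      mul_mem' := fun {θ η} hθ hη => by
        have := R.mul_mem hθ hη
        rwa [tmul_mul_one_tmul] at this
      add_mem' := fun {θ η} hθ hη => by
        have := R.add_mem hθ hη
        rwa [← map_add, ← TensorProduct.tmul_add] at this
      algebraMap_mem' := fun r => by
        have := R.smul_mem R.one_mem r
        rwa [one_def, ← map_smul, ← TensorProduct.tmul_smul,
          ← Algebra.algebraMap_eq_smul_one] at this }
  -- If `R` contains all `b₀ ⊗ f(b₁)`, it contains all `a b₀ ⊗ f(b₁)`; as the `a b₀ ⊗ b₁` span `A ⊗
  -- H`, it contains `1 ⊗ f(h)`. This is used for `f = (θ ↼ ·)` and for `f = ϖ`.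
  have key : ∀ f : H →ₗ[k] C.Lam, (∀ b, of δ C (f.lTensor A (δ.coact b)) ∈ R) →
      ∀ h, f h ∈ T := fun f hf h => by
    refine δ.map_mem_of_canonicalMap_surjective hs ((of δ C).toLinearMap ∘ₗ f.lTensor A)
      (Subalgebra.toSubmodule R) (fun a b => ?_) (1 ⊗ₜ h)
    have := R.mul_mem (hA a) (hf b)
    rwa [inA_mul_lTensor] at this
  have hT : T = ⊤ := by
    refine C.eq_top_of_maurerCartan_mem T (fun θ hθ => key _ fun b => ?_) (key _ fun b => ?_)
    · rw [← one_tmul_mul_inA]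
      exact R.mul_mem hθ (hA b)
    · rw [← D_inA]
      exact hD b
  refine eq_top_iff.2 fun x _ => ?_
  obtain ⟨x, rfl⟩ := (of δ C).surjective x
  induction x with
  | zero => simp
  | add x y hx hy => rw [map_add]; exact R.add_mem (hx trivial) (hy trivial)
  | tmul a θ =>
    have hθ : θ ∈ T := hT ▸ Algebra.mem_top
    have := R.mul_mem (hA a) hθ
    rwa [inA_mul_tmul, mul_one] at this

/-- `(id ⊗ π_inv)` is a left inverse of `a ⊗ θ ↦ a₀ ⊗ a₁ θ`. -/
lemma lTensor_piInv_emb (x : Ver δ C) : C.piInv.lTensor A (emb δ C x) = (of δ C).symm x := by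
  obtain ⟨x, rfl⟩ := (of δ C).surjective x
  induction x with
  | zero => simp
  | add x y hx hy => simp only [map_add, hx, hy]
  | tmul a θ =>
    rw [emb_tmul, ComoduleAlgebra.pushHom_apply, ComoduleAlgebra.push_apply,
      LinearEquiv.symm_apply_apply]
    -- With `a` written as `a₀ ε(a₁)`, the identity follows from `π_inv(a₁θ) = ε(a₁)θ`.
    conv_rhs => rw [← δ.counit a]
    generalize δ.coact a = t
    induction t with
    | zero => simp
    | add x y hx hy => simp only [map_add, add_mul, TensorProduct.add_tmul, hx, hy]
    | tmul b h =>
      simp [FODC.LeftCovariant.piInv_inH_mul, TensorProduct.smul_tmul]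

/-- Here `π_inv` is split into the left coaction followed by `h ⊗ ω ↦ S(h)ω`. The coaction is
multiplicative, so the antipode needs to be applied only once, after all products have been formed.
-/
lemma incl_eq (x : Ver δ C) : incl δ C x = (FODC.LeftCovariant.antipMul F).lTensor A
    (C.coaction.toLinearMap.lTensor A (emb δ C x)) := by
  have h : incl δ C x = C.Lam.val.toLinearMap.lTensor A (C.piInv.lTensor A (emb δ C x)) := by
    rw [lTensor_piInv_emb]; rfl
  rw [h, ← LinearMap.comp_apply (LinearMap.lTensor A _), ← LinearMap.comp_apply
    (LinearMap.lTensor A _), ← LinearMap.lTensor_comp, ← LinearMap.lTensor_comp]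
  rfl

lemma inA_mem_grade (a : A) : inA δ C a ∈ grade δ C 0 :=
  tmul_mem_grade δ C a (C.mem_LamGrade.2 SetLike.GradedOne.one_mem)

end Ver

/-! ### The left coaction on forms, for the explicit formula -/

lemma ComoduleAlgebra.lTensor_push {R R' : Type*} [Ring R] [Algebra k R] [Ring R'] [Algebra k R']
    (g : R →ₗ[k] R') (f : H →ₗ[k] R) (a : A) : g.lTensor A (δ.push f a) = δ.push (g ∘ₗ f) a := by
  rw [push_apply, push_apply, LinearMap.lTensor_comp, LinearMap.comp_apply]

/-- The coaction takes `a⁰₀ a¹₀ … ⊗ a⁰₁ da¹₁ ∧ …` to the product of the `aⁱ₀ ⊗ aⁱ₁ ⊗ daⁱ₂`. -/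
lemma lTensor_coaction_form {n : ℕ} (a : Fin (n + 1) → A) :
    C.coaction.toLinearMap.lTensor A (form (δ.pushHom F.inH) (F.D.lTensor A) a) =
      δ.push₂ F.inH.toLinearMap (a 0) *
        (List.ofFn fun i : Fin n => δ.push₂ (F.D ∘ₗ F.inH.toLinearMap) (a i.succ)).prod := by
  have h₁ : C.coaction.toLinearMap ∘ₗ F.inH.toLinearMap =
      F.inH.toLinearMap.lTensor H ∘ₗ Coalgebra.comul := by ext; simp
  -- Left colinearity of the differential: the coaction sends `dh` to `h₁ ⊗ dh₂`.
  have h₂ : C.coaction.toLinearMap ∘ₗ (F.D ∘ₗ F.inH.toLinearMap) =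
      (F.D ∘ₗ F.inH.toLinearMap).lTensor H ∘ₗ Coalgebra.comul := by
    ext h
    simp [FODC.LeftCovariant.coaction_D, LinearMap.lTensor_comp]
  have h₃ : ∀ b, C.coaction.toLinearMap.lTensor A (δ.pushHom F.inH b) =
      δ.push₂ F.inH.toLinearMap b := fun b => by
    rw [ComoduleAlgebra.pushHom_apply, δ.lTensor_push, h₁]; rfl
  have h₄ : ∀ b, C.coaction.toLinearMap.lTensor A (F.D.lTensor A (δ.pushHom F.inH b)) =
      δ.push₂ (F.D ∘ₗ F.inH.toLinearMap) b := fun b => by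
    rw [ComoduleAlgebra.pushHom_apply, δ.lTensor_push, δ.lTensor_push, h₂]; rfl
  -- The same map as an algebra morphism, so that it distributes over the product in a form.
  let φ : A ⊗[k] F.MaxProlong →ₐ[k] A ⊗[k] (H ⊗[k] F.MaxProlong) :=
    Algebra.TensorProduct.map (AlgHom.id k A) C.coaction
  have hφ : ∀ t, C.coaction.toLinearMap.lTensor A t = φ t := fun t => rfl
  rw [hφ, form, map_mul, map_list_prod, List.map_ofFn, ← hφ, h₃]
  simp only [Function.comp_def, ← hφ, h₄]

end Generation

end NCBundle

end

/-! ### The vertical projection -/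

theorem mainTheorem2 {k H A Γ Ω : Type*} [Field k] [Ring H] [HopfAlgebra k H]
    [Ring A] [Algebra k A] [AddCommGroup Γ] [Module k Γ] [Module H Γ] [Module Hᵐᵒᵖ Γ]
    [SMulCommClass H Hᵐᵒᵖ Γ] [IsScalarTower k H Γ] [IsScalarTower k Hᵐᵒᵖ Γ]
    [Ring Ω] [Algebra k Ω]
    (F : NCBundle.FODC k H Γ) (C : F.Bicovariant)
    (δ : NCBundle.ComoduleAlgebra k H A) (hδ : δ.IsQuantumPrincipalBundle)
    (incl : A →ₐ[k] Ω) (𝒜 : ℕ → Submodule k Ω) [GradedAlgebra 𝒜] (d : Ω →ₗ[k] Ω)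
    (hΩ : NCBundle.IsDifferentialCalculus incl 𝒜 d)
    (Δ : Ω →ₐ[k] 𝒜 ᵍ⊗[k] F.grade) (hΔ : NCBundle.IsCoactionExtension δ F incl 𝒜 d Δ) :
    ∃ π : Ω →ₐ[k] NCBundle.Ver δ C.left,
      NCBundle.IsDGAHom 𝒜 d (NCBundle.Ver.grade δ C.left) (NCBundle.Ver.D δ C.left) π ∧
      (∀ a, π (incl a) = NCBundle.Ver.inA δ C.left a) ∧
      Function.Surjective π ∧
      (∀ π' : Ω →ₐ[k] NCBundle.Ver δ C.left,
        NCBundle.IsDGAHom 𝒜 d (NCBundle.Ver.grade δ C.left) (NCBundle.Ver.D δ C.left) π' →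
        (∀ a, π' (incl a) = NCBundle.Ver.inA δ C.left a) → π' = π) ∧
      (∀ n, ∀ ω ∈ 𝒜 n,
        incl.toLinearMap.rTensor C.left.Lam ((NCBundle.Ver.of δ C.left).symm (π ω)) =
          (C.left.piInv ∘ₗ GradedAlgebra.proj F.grade n).lTensor Ω
            ((GradedTensorProduct.of k 𝒜 F.grade).symm (Δ ω))) ∧
      (∀ (n : ℕ) (a : Fin (n + 1) → A),
        NCBundle.Ver.incl δ C.left (π (NCBundle.form incl d a)) = NCBundle.verticalForm δ F a) := by
  obtain ⟨p, hp⟩ := hΩ.exists_degreeZero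
  have hp₀ : ∀ n, n ≠ 0 → ∀ x ∈ 𝒜 n, p x = 0 := fun n hn x hx =>
    NCBundle.degreeZero_of_mem_ne hp hΩ.incl_injective hn hx
  have hpi : ∀ a, p (incl a) = a := fun a => hΩ.incl_injective (by
    have ha : incl a ∈ 𝒜 0 := hΩ.range_incl ▸ ⟨a, rfl⟩
    rw [hp, NCBundle.proj_of_mem_graded ha, if_pos rfl])
  -- `Φ = (p ⊗ id) ∘ Δ` keeps the part of `Δ` whose left factor has degree zero; it will turn out to
  -- be `emb ∘ π`.
  let Φ : Ω →ₐ[k] A ⊗[k] F.MaxProlong := (NCBundle.degreeZeroTensor F.grade hp₀).comp Δ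
  have hΦ : ∀ ω, Φ ω = p.toLinearMap.rTensor F.MaxProlong
      ((GradedTensorProduct.of k 𝒜 F.grade).symm (Δ ω)) := fun ω =>
    NCBundle.degreeZeroTensor_apply hp₀ (Δ ω)
  have hΦd : ∀ ω, Φ (d ω) = F.D.lTensor A (Φ ω) := fun ω => by
    change NCBundle.degreeZeroTensor F.grade hp₀ (Δ (d ω)) = _
    rw [hΔ.isDGAHom.map_d, NCBundle.degreeZeroTensor_tensorD hp₀ hΩ.d_mem]
    rfl
  have hΦi : ∀ a, Φ (incl a) = δ.pushHom F.inH a := fun a => by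
    rw [hΦ, hΔ.extends_coact, GradedTensorProduct.of_symm_of, NCBundle.ComoduleAlgebra.pushHom_apply,
      NCBundle.ComoduleAlgebra.push_apply]
    generalize δ.coact a = t
    induction t with
    | zero => simp
    | add x y hx hy => simp only [map_add, hx, hy]
    | tmul b h => simp [hpi]
  have hΦform : ∀ (n : ℕ) (a : Fin (n + 1) → A), Φ (NCBundle.form incl d a) =
      NCBundle.form (δ.pushHom F.inH) (F.D.lTensor A) a := fun n a =>
    NCBundle.map_form hΦi (fun b => by rw [hΦd, hΦi]) a
  have hembform : ∀ (n : ℕ) (a : Fin (n + 1) → A), NCBundle.Ver.emb δ C.left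
      (NCBundle.form (NCBundle.Ver.inA δ C.left) (NCBundle.Ver.D δ C.left) a) =
      NCBundle.form (δ.pushHom F.inH) (F.D.lTensor A) a := fun n a =>
    NCBundle.map_form (f := NCBundle.Ver.embHom δ C.left) (NCBundle.Ver.emb_inA δ C.left)
      (fun b => by
        rw [NCBundle.Ver.embHom_apply, NCBundle.Ver.emb_D, NCBundle.Ver.emb_inA]) a
  -- On a form, `Φ` agrees with `emb` of the vertical form with the same entries; since forms span
  -- `Ω`, the whole image of `Φ` lies in the range of `emb`.
  have hrange : ∀ ω, Φ ω ∈ (NCBundle.Ver.embHom δ C.left).range := fun ω =>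
    hΩ.le_of_form_mem (N := (Subalgebra.toSubmodule
      (NCBundle.Ver.embHom δ C.left).range).comap Φ.toLinearMap)
      (fun n a => ⟨_, (hembform n a).trans (hΦform n a).symm⟩) ω
  let π : Ω →ₐ[k] NCBundle.Ver δ C.left :=
    (AlgEquiv.ofInjective (NCBundle.Ver.embHom δ C.left)
      (NCBundle.Ver.emb_injective δ C.left)).symm.toAlgHom.comp (Φ.codRestrict _ hrange)
  have hπ : ∀ ω, NCBundle.Ver.emb δ C.left (π ω) = Φ ω := fun ω =>
    congrArg Subtype.val ((AlgEquiv.ofInjective (NCBundle.Ver.embHom δ C.left)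
      (NCBundle.Ver.emb_injective δ C.left)).apply_symm_apply (Φ.codRestrict _ hrange ω))
  have hπd : ∀ ω, π (d ω) = NCBundle.Ver.D δ C.left (π ω) := fun ω =>
    -- Identities for `π` are tested after the injective morphism `emb`, where they become
    -- identities for `Φ`.
    NCBundle.Ver.emb_injective δ C.left (by rw [hπ, NCBundle.Ver.emb_D, hπ, hΦd])
  have hπi : ∀ a, π (incl a) = NCBundle.Ver.inA δ C.left a := fun a =>
    NCBundle.Ver.emb_injective δ C.left (by rw [hπ, NCBundle.Ver.emb_inA, hΦi])
  refine ⟨π, ⟨fun n ω hω => ?_, hπd⟩, hπi, ?_, fun π' hπ' hπ'i => ?_, fun n ω hω => ?_,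
    fun n a => ?_⟩
  · have hgr := NCBundle.Ver.isDGA δ C.left
    have := hgr.graded
    -- Degrees are not read off from `Φ`: `π` sends the form with entries `aⁱ` to the vertical form
    -- with the same entries and the same degree.
    rw [hΩ.generated] at hω
    refine (Submodule.span_le.2 ?_ : _ ≤ (NCBundle.Ver.grade δ C.left n).comap π.toLinearMap) hω
    rintro _ ⟨a, rfl⟩
    change π _ ∈ NCBundle.Ver.grade δ C.left n
    rw [NCBundle.map_form hπi (fun b => by rw [hπd, hπi]) a]
    exact NCBundle.form_mem (NCBundle.Ver.inA_mem_grade δ C.left) hgr.d_mem a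
  · rw [← AlgHom.range_eq_top]
    exact NCBundle.Ver.eq_top_of_inA_mem δ C.left hδ.hopfGalois.surjective _
      (fun a => ⟨_, hπi a⟩) (fun a => ⟨_, (hπd _).trans (by rw [hπi])⟩)
  · exact hΩ.algHom_ext hπ'.map_d hπd fun a => by rw [hπ'i, hπi]
  · have hproj : GradedAlgebra.proj 𝒜 0 = incl.toLinearMap ∘ₗ p.toLinearMap :=
      LinearMap.ext fun x => (hp x).symm
    -- `π ω = (id ⊗ π_inv)(Φ ω)`. On the other side, `Δ ω` has total degree `n`, so projecting its
    -- right factor on degree `n` amounts to projecting its left factor on degree zero, that is, to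
    -- applying `incl ∘ p` there.
    rw [← NCBundle.Ver.lTensor_piInv_emb, hπ, hΦ, LinearMap.lTensor_comp, LinearMap.comp_apply,
      NCBundle.lTensor_proj_of_mem_tensorGrade (hΔ.isDGAHom.map_mem n ω hω), hproj,
      LinearMap.rTensor_comp, LinearMap.comp_apply]
    -- Both sides are now `((incl ∘ p) ⊗ π_inv)(Δ ω)`, since maps on different tensor factors
    -- commute.
    rw [← LinearMap.comp_apply (LinearMap.rTensor _ _), ← LinearMap.comp_apply
      (LinearMap.lTensor _ _), LinearMap.rTensor_comp_lTensor, LinearMap.lTensor_comp_rTensor]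
  · rw [NCBundle.Ver.incl_eq, hπ, hΦform, NCBundle.lTensor_coaction_form]
    rfl
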